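/- Conventions. A first-order structure is called ranked if the following Borovik--Poizat conditions hold for its interpretable sets, that is, the quotients of definable sets by definable equivalence relations ("definable" always allows parameters). Put $\mathrm{rk}(A)\ge 0$ if $A\neq\emptyset$, and $\mathrm{rk}(A)\ge k+1$ if $A$ has infinitely many pairwise disjoint definable subsets of rank $\ge k$; then (a) every nonempty interpretable set has finite rank; and for every definable map $f:A\to B$ between interpretable sets, (b) for each $k$ the set $\{b\in B : \mathrm{rk}(f^{-1}(b))=k\}$ is definable, (c) if $f$ is surjective and all its fibres have rank $k$, then $\mathrm{rk}(A)=\mathrm{rk}(B)+k$, and (d) there is a finite bound on the cardinalities of the finite fibres of $f$. A group of finite Morley rank is a group $G$, possibly with additional first-order structure, with definable multiplication, that is ranked. A definable subset $X$ of a definable set $Y$ is generic in $Y$ if $\mathrm{rk}(X)=\mathrm{rk}(Y)$. A definable subset $X\subseteq G$ is generous if $\{x^g : x\in X,\ g\in G\}$ is generic in $G$. A subgroup $Q$ of $G$ is connected if $Q\le K$ for every definable subgroup $K$ of $G$ such that $Q\cap K$ has finite index in $Q$ (for definable $Q$: $Q$ has no proper definable subgroup of finite index). We say that, generically, elements of $G$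 belong to connected nilpotent subgroups if one of the following holds: (i) $G$ has a definable generic subset each of whose elements belongs to a connected nilpotent (not necessarily definable) subgroup of $G$; or (ii) the structure $G$ is saturated and, for some set $A\subseteq G$ with $|A|<|G|$, each element of $G$ that realizes the generic type over $A$ (that is, lies in every $A$-definable generic subset of $G$) belongs to a connected nilpotent subgroup of $G$. Statement. Let $G$ be a connected group of finite Morley rank in which, generically, elements belong to connected nilpotent subgroups. Suppose that $H$ is a definable connected generous subgroup of $G$, that $w\in N_G(H)\setminus H$ has finite order $n$ modulo $H$, and that $\{h^n : h\in H\}$ is generic in $H$. Then $C_H(w)<H$, that is, $C_H(w)$ is a proper subgroup of $H$. -/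

import Mathlib

universe u v w

namespace FMR

variable (L : FirstOrder.Language.{u, v}) {G : Type w} [L.Structure G]

/-- An interpretable set of the structure `G`: a quotient `X / E` of a definable subset `X` of
some power `G ^ n` by a definable equivalence relation `E` on `X` (parameters from `G` are
allowed). It is represented by the set `S` of its elements, the `E`-classes, which are nonempty
pairwise disjoint subsets of `G ^ n`; then `x E y` if and only if `x` and `y` lie in a common
member of `S`, and `X` is the domain of `E`. A definable subset of `X / E` is an
interpretable subset of `S`. -/
def IsInterpretable {n : ℕ} (S : Set (Set (Fin n → G))) : Prop :=
  ∅ ∉ S ∧ S.PairwiseDisjoint id ∧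
    (Set.univ : Set G).Definable L
      {v : Fin n ⊕ Fin n → G | ∃ c ∈ S, v ∘ Sum.inl ∈ c ∧ v ∘ Sum.inr ∈ c}

/-- A definable map between interpretable sets (only the values of `f` on `S` matter). -/
def IsDefinableMap {m n : ℕ} (S : Set (Set (Fin m → G))) (T : Set (Set (Fin n → G)))
    (f : Set (Fin m → G) → Set (Fin n → G)) : Prop :=
  Set.MapsTo f S T ∧
    (Set.univ : Set G).Definable L
      {v : Fin m ⊕ Fin n → G | ∃ c ∈ S, v ∘ Sum.inl ∈ c ∧ v ∘ Sum.inr ∈ f c}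

/-- `RankGE L k S` says `rk S ≥ k`: we have `rk S ≥ 0` if `S` is nonempty, and `rk S ≥ k + 1` if
`S` has infinitely many pairwise disjoint interpretable subsets of rank at least `k`. -/
def RankGE {n : ℕ} : ℕ → Set (Set (Fin n → G)) → Prop
  | 0, S => S.Nonempty
  | k + 1, S => ∃ B : ℕ → Set (Set (Fin n → G)),
      (∀ i j, i ≠ j → Disjoint (B i) (B j)) ∧
        ∀ i, B i ⊆ S ∧ IsInterpretable L (B i) ∧ RankGE k (B i)

/-- `rk S = k`. -/
def HasRank {n : ℕ} (S : Set (Set (Fin n → G))) (k : ℕ) : Prop :=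
  RankGE L k S ∧ ¬ RankGE L (k + 1) S

variable (G) in
/-- The Borovik-Poizat axioms for a ranked structure. The monotonicity axiom
(`rk S ≥ k + 1` if and only if `S` has infinitely many disjoint definable subsets of rank at
least `k`) is the definition of the rank, so that what remains of it is that the rank is finite. -/
structure IsRanked : Prop where
  finite_rank : ∀ {n : ℕ} (S : Set (Set (Fin n → G))), IsInterpretable L S →
    ∃ k : ℕ, ¬ RankGE L k S
  definability : ∀ {m n : ℕ} (S : Set (Set (Fin m → G))) (T : Set (Set (Fin n → G)))
    (f : Set (Fin m → G) → Set (Fin n → G)),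
    IsInterpretable L S → IsInterpretable L T → IsDefinableMap L S T f →
    ∀ k : ℕ, IsInterpretable L {t | t ∈ T ∧ HasRank L {s | s ∈ S ∧ f s = t} k}
  additivity : ∀ {m n : ℕ} (S : Set (Set (Fin m → G))) (T : Set (Set (Fin n → G)))
    (f : Set (Fin m → G) → Set (Fin n → G)),
    IsInterpretable L S → IsInterpretable L T → IsDefinableMap L S T f → Set.SurjOn f S T →
    ∀ j k : ℕ, HasRank L T j → (∀ t ∈ T, HasRank L {s | s ∈ S ∧ f s = t} k) →
      HasRank L S (j + k)
  elimination : ∀ {m n : ℕ} (S : Set (Set (Fin m → G))) (T : Set (Set (Fin n → G)))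
    (f : Set (Fin m → G) → Set (Fin n → G)),
    IsInterpretable L S → IsInterpretable L T → IsDefinableMap L S T f →
    ∃ N : ℕ, ∀ t ∈ T, {s | s ∈ S ∧ f s = t}.Finite → {s | s ∈ S ∧ f s = t}.ncard ≤ N

variable (G) in
/-- A group of finite Morley rank: a group, possibly with additional structure, which is ranked
in the sense of Borovik and Poizat. -/
structure IsGroupOfFiniteMorleyRank [Group G] : Prop where
  mul_definable : (Set.univ : Set G).Definable L {v : Fin 3 → G | v 0 * v 1 = v 2}
  ranked : IsRanked L G

/-- `X` is a definable subset of `G` (with parameters from `G`). -/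
def IsDefinable (X : Set G) : Prop :=
  (Set.univ : Set G).Definable₁ L X

/-- A subset of `G`, as a set of one-element subsets of `G ^ 1`. -/
def points (X : Set G) : Set (Set (Fin 1 → G)) :=
  (fun x : G => ({fun _ => x} : Set (Fin 1 → G))) '' X

/-- `X` is a definable generic subset of `Y`, that is `rk X = rk Y`. -/
def IsGenericIn (X Y : Set G) : Prop :=
  IsDefinable L X ∧ X ⊆ Y ∧ ∃ k : ℕ, HasRank L (points X) k ∧ HasRank L (points Y) k

/-- A subgroup `Q` is connected if it has no proper relatively definable subgroup of finite
index: a definable subgroup `K` of `G` with `Q ∩ K` of finite index in `Q` contains `Q`.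
For definable `Q` this says that `Q` has no proper definable subgroup of finite index. -/
def IsConnectedSubgroup [Group G] (Q : Subgroup G) : Prop :=
  ∀ K : Subgroup G, IsDefinable L (K : Set G) → K.relIndex Q ≠ 0 → Q ≤ K

/-- A definable subset `X` is generous if the union of its conjugates is generic in `G`. -/
def IsGenerous [Group G] (X : Set G) : Prop :=
  IsDefinable L X ∧ IsGenericIn L {y : G | ∃ x ∈ X, ∃ g : G, y = g⁻¹ * x * g} Set.univ

variable (G) in
/-- The structure `G` is saturated: over each set `A` of fewer than `|G|` parameters, every
finitely satisfiable family of `A`-definable subsets of `G` is satisfiable. -/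
def IsSaturated : Prop :=
  ∀ A : Set G, Cardinal.mk A < Cardinal.mk G →
    ∀ F : Set (Set G), (∀ X ∈ F, A.Definable₁ L X) →
      (∀ F' : Set (Set G), F' ⊆ F → F'.Finite → (⋂₀ F').Nonempty) → (⋂₀ F).Nonempty

/-- `g` realizes the generic type over `A` : it lies in every generic subset of `G` that is
definable with parameters from `A`. -/
def IsGenericOver (A : Set G) (g : G) : Prop :=
  ∀ X : Set G, A.Definable₁ L X → IsGenericIn L X Set.univ → g ∈ X

/-- `g` belongs to a connected nilpotent subgroup, which need not be definable. -/
def InConnectedNilpotent [Group G] (g : G) : Prop :=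
  ∃ Q : Subgroup G, IsConnectedSubgroup L Q ∧ Group.IsNilpotent Q ∧ g ∈ Q

variable (G) in
/-- Generically, elements of `G` belong to connected nilpotent subgroups: either all elements of
some definable generic subset of `G` do, or `G` is saturated and all realizations of the generic
type (over some set of fewer than `|G|` parameters) do. -/
def GenericallyInConnectedNilpotent [Group G] : Prop :=
  (∃ X : Set G, IsGenericIn L X Set.univ ∧ ∀ g ∈ X, InConnectedNilpotent L g) ∨
  (IsSaturated L G ∧ ∃ A : Set G, Cardinal.mk A < Cardinal.mk G ∧
    ∀ g : G, IsGenericOver L A g → InConnectedNilpotent L g)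

end FMR

namespace FMR

open Set
open scoped commutatorElement

/-! ### Rank calculus for definable sets of tuples. -/

section

variable {L : FirstOrder.Language.{u, v}} {G : Type w} [L.Structure G] {m n : ℕ}

/-! Suppose `w` centralizes `H`. Since `H` is generous, counting ranks along conjugation `G × H → G`
shows that generic `y ∈ H` have a transporter `{g | g y g⁻¹ ∈ H}` of rank only `rk H`, that is,
consisting of finitely many cosets of `H` (`rkGE_inter_of_isGenerous`, `exists_mul_inv_mem`). As `(w
h) ^ n = w ^ n h ^ n` and the `n`-th powers are generic in `H`, the elements `u ∈ w H` for which `u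
^ n` has such a transporter form a set of rank `rk H`. An element conjugating `y` into `w H`
conjugates `y ^ n` into `H`, so the fibres of conjugation over the conjugates of these `u` have rank
at most `rk H`. Hence the conjugates form a generic set (`exists_generic_conj_coset`).

Two generic sets of a connected group meet (`rkGE_inter`), so some conjugate `x = g⁻¹ u g` lies in a
connected nilpotent `Q`. The elements `a` whose commutator with `x` lies in `g⁻¹ H g` conjugate `x`
into `x (g⁻¹ H g)`, and smallness of the transporter of `x ^ n` leaves them only finitely many
cosets of `g⁻¹ H g`. Climbing the upper central series of `Q` then yields `Q ≤ g⁻¹ H g`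
(`le_of_isNilpotent`). So `u ∈ H`, and `w ∈ H`, a contradiction. -/

/-- The one-element subsets of a set `X`: the presentation of `X` as an interpretable set. -/
def singletons (X : Set (Fin n → G)) : Set (Set (Fin n → G)) :=
  (fun v => {v}) '' X

variable (L) in
/-- A definable (with parameters) set of tuples. -/
abbrev Def (X : Set (Fin n → G)) : Prop :=
  (univ : Set G).Definable L X

variable (L) in
/-- A definable (with parameters) map between powers of the structure. -/
abbrev DefMap (f : (Fin m → G) → Fin n → G) : Prop :=
  (univ : Set G).DefinableMap L f

variable (L) in
/-- The rank of a set of tuples is at least `k`. -/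
def RkGE (k : ℕ) (X : Set (Fin n → G)) : Prop :=
  RankGE L k (singletons X)

variable (L) in
/-- The rank of a set of tuples is `k`. -/
def Rk (X : Set (Fin n → G)) (k : ℕ) : Prop :=
  RkGE L k X ∧ ¬ RkGE L (k + 1) X

lemma singletons_mono {X Y : Set (Fin n → G)} (h : X ⊆ Y) : singletons X ⊆ singletons Y :=
  image_mono h

lemma mem_singletons {X : Set (Fin n → G)} {v : Fin n → G} : {v} ∈ singletons X ↔ v ∈ X := by
  simp [singletons]

lemma isInterpretable_singletons {X : Set (Fin n → G)} :
    IsInterpretable L (singletons X) ↔ Def L X := by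
  have key : {v : Fin n ⊕ Fin n → G | ∃ c ∈ singletons X, v ∘ Sum.inl ∈ c ∧ v ∘ Sum.inr ∈ c} =
      {v | v ∘ Sum.inl ∈ X ∧ ∀ i, v (Sum.inl i) = v (Sum.inr i)} := by
    ext v
    constructor
    · rintro ⟨_, ⟨a, ha, rfl⟩, h1, h2⟩
      simp only [mem_singleton_iff] at h1 h2
      exact ⟨by rwa [h1], fun i => (congrFun h1 i).trans (congrFun h2 i).symm⟩
    · rintro ⟨h1, h2⟩
      exact ⟨_, ⟨_, h1, rfl⟩, rfl, funext fun i => (h2 i).symm⟩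
  constructor
  · rintro ⟨-, -, h⟩
    rw [key] at h
    convert! h.preimage_comp (Sum.elim id id)
    ext v
    simp [Function.comp_def]
  · intro h
    refine ⟨?_, ?_, ?_⟩
    · rintro ⟨v, -, hv⟩
      exact (singleton_ne_empty v) hv
    · rintro _ ⟨a, -, rfl⟩ _ ⟨b, -, rfl⟩ hab
      simpa [Function.onFun] using fun h => hab (by simp [h])
    · rw [key]
      have := (h.preimage_comp Sum.inl).inter (definable_iInter_of_finite fun i : Fin n =>
        DefinableFun.ofPred_eq (L := L) (A := (univ : Set G)) (DefinableFun.proj L (i := Sum.inl i))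
          (DefinableFun.proj L (i := Sum.inr i)))
      convert! this using 1
      ext v
      simp

lemma exists_singletons_of_subset {X : Set (Fin n → G)} {S : Set (Set (Fin n → G))}
    (h : S ⊆ singletons X) : ∃ Y ⊆ X, S = singletons Y := by
  refine ⟨{v : Fin n → G | {v} ∈ S}, fun v hv => ?_, ?_⟩
  · exact mem_singletons.1 (h (mem_ofPred.1 hv))
  ext c
  constructor
  · intro hc
    obtain ⟨v, -, rfl⟩ := h hc
    exact ⟨v, hc, rfl⟩
  · rintro ⟨v, hv, rfl⟩
    exact hv

lemma disjoint_singletons {X Y : Set (Fin n → G)} :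
    Disjoint (singletons X) (singletons Y) ↔ Disjoint X Y :=
  disjoint_image_iff singleton_injective

lemma rkGE_zero {X : Set (Fin n → G)} : RkGE L 0 X ↔ X.Nonempty := by
  simp [RkGE, RankGE, singletons]

lemma rkGE_succ {k : ℕ} {X : Set (Fin n → G)} :
    RkGE L (k + 1) X ↔ ∃ B : ℕ → Set (Fin n → G), (∀ i j, i ≠ j → Disjoint (B i) (B j)) ∧
      ∀ i, B i ⊆ X ∧ Def L (B i) ∧ RkGE L k (B i) := by
  constructor
  · rintro ⟨B, hd, hB⟩
    choose C hC hBC using fun i => exists_singletons_of_subset (hB i).1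
    refine ⟨C, fun i j hij => ?_, fun i => ⟨hC i, ?_, ?_⟩⟩
    · rw [← disjoint_singletons, ← hBC, ← hBC]
      exact hd i j hij
    · rw [← isInterpretable_singletons, ← hBC]
      exact (hB i).2.1
    · rw [RkGE, ← hBC]
      exact (hB i).2.2
  · rintro ⟨B, hd, hB⟩
    exact ⟨fun i => singletons (B i), fun i j hij => disjoint_singletons.2 (hd i j hij),
      fun i => ⟨singletons_mono (hB i).1, isInterpretable_singletons.2 (hB i).2.1, (hB i).2.2⟩⟩

lemma RkGE.mono {k : ℕ} {X Y : Set (Fin n → G)} (h : RkGE L k X) (hXY : X ⊆ Y) : RkGE L k Y := by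
  cases k with
  | zero => exact rkGE_zero.2 ((rkGE_zero.1 h).mono hXY)
  | succ k =>
    obtain ⟨B, hd, hB⟩ := rkGE_succ.1 h
    exact rkGE_succ.2 ⟨B, hd, fun i => ⟨(hB i).1.trans hXY, (hB i).2⟩⟩

lemma RkGE.of_succ {k : ℕ} {X : Set (Fin n → G)} (h : RkGE L (k + 1) X) : RkGE L k X := by
  obtain ⟨B, -, hB⟩ := rkGE_succ.1 h
  exact (hB 0).2.2.mono (hB 0).1

lemma RkGE.of_le {j k : ℕ} {X : Set (Fin n → G)} (h : RkGE L k X) (hjk : j ≤ k) : RkGE L j X := by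
  induction k, hjk using Nat.le_induction with
  | base => exact h
  | succ k _ ih => exact ih h.of_succ

lemma RkGE.nonempty {k : ℕ} {X : Set (Fin n → G)} (h : RkGE L k X) : X.Nonempty :=
  rkGE_zero.1 (h.of_le (Nat.zero_le k))

lemma Rk.le {j k : ℕ} {X : Set (Fin n → G)} (h : Rk L X k) (hj : RkGE L j X) : j ≤ k := by
  by_contra! hlt
  exact h.2 (hj.of_le hlt)

lemma Rk.eq {j k : ℕ} {X : Set (Fin n → G)} (h : Rk L X k) (hj : Rk L X j) : j = k :=
  le_antisymm (h.le hj.1) (hj.le h.1)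

/-- The image of a definable set under a definable surjection has no larger rank. -/
lemma RkGE.of_surjOn {f : (Fin m → G) → Fin n → G} (hf : DefMap L f) {k : ℕ}
    {X : Set (Fin m → G)} {Y : Set (Fin n → G)} (hX : Def L X) (hXY : SurjOn f X Y)
    (h : RkGE L k Y) : RkGE L k X := by
  induction k generalizing X Y with
  | zero =>
    obtain ⟨y, hy⟩ := rkGE_zero.1 h
    obtain ⟨x, hx, -⟩ := hXY hy
    exact rkGE_zero.2 ⟨x, hx⟩
  | succ k ih =>
    obtain ⟨B, hd, hB⟩ := rkGE_succ.1 h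
    have hdef : ∀ i, Def L (X ∩ f ⁻¹' B i) := fun i => hX.inter ((hB i).2.1.preimage_map hf)
    refine rkGE_succ.2 ⟨fun i => X ∩ f ⁻¹' B i, fun i j hij => ?_, fun i =>
      ⟨inter_subset_left, hdef i, ih (hdef i) (fun y hy => ?_) (hB i).2.2⟩⟩
    · exact ((hd i j hij).preimage f).mono inter_subset_right inter_subset_right
    · obtain ⟨x, hx, rfl⟩ := hXY ((hB i).1 hy)
      exact ⟨x, ⟨hx, hy⟩, rfl⟩

/-- Pigeonhole: each of the infinitely many disjoint pieces witnessing the rank of the union is, by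
induction, large inside one of the two sets, and one of them is chosen infinitely often. -/
lemma RkGE.union {k : ℕ} {X Y : Set (Fin n → G)} (hX : Def L X) (hY : Def L Y)
    (h : RkGE L k (X ∪ Y)) : RkGE L k X ∨ RkGE L k Y := by
  induction k generalizing X Y with
  | zero => simpa [rkGE_zero] using h
  | succ k ih =>
    obtain ⟨B, hd, hB⟩ := rkGE_succ.1 h
    have key : ∀ i, RkGE L k (X ∩ B i) ∨ RkGE L k (Y ∩ B i) := fun i => by
      refine ih (hX.inter (hB i).2.1) (hY.inter (hB i).2.1) ?_
      rw [← union_inter_distrib_right, inter_eq_self_of_subset_right (hB i).1]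
      exact (hB i).2.2
    have main : ∀ Z : Set (Fin n → G), Def L Z → {i | RkGE L k (Z ∩ B i)}.Infinite →
        RkGE L (k + 1) Z := fun Z hZ hinf => by
      refine rkGE_succ.2 ⟨fun i => Z ∩ B (hinf.natEmbedding _ i), fun i j hij => ?_, fun i =>
        ⟨inter_subset_left, hZ.inter (hB _).2.1, (hinf.natEmbedding _ i).2⟩⟩
      refine (hd _ _ fun h => hij ?_).mono inter_subset_right inter_subset_right
      exact (hinf.natEmbedding _).injective (Subtype.ext h)
    by_contra! hcon
    have h1 := not_infinite.1 fun h => hcon.1 (main X hX h)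
    have h2 := not_infinite.1 fun h => hcon.2 (main Y hY h)
    exact infinite_univ ((h1.union h2).subset fun i _ => key i)

lemma RkGE.biUnion {ι : Type*} {k : ℕ} (s : Finset ι) {X : ι → Set (Fin n → G)}
    (hX : ∀ i, Def L (X i)) (h : RkGE L k (⋃ i ∈ s, X i)) : ∃ i ∈ s, RkGE L k (X i) := by
  classical
  induction s using Finset.induction_on with
  | empty => simpa using h.nonempty
  | insert a s _ ih =>
    rw [Finset.set_biUnion_insert] at h
    rcases h.union (hX a) (definable_biUnion_finset hX s) with h | h
    · exact ⟨a, Finset.mem_insert_self a s, h⟩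
    · obtain ⟨i, hi, h⟩ := ih h
      exact ⟨i, Finset.mem_insert_of_mem hi, h⟩

lemma isDefinableMap_image {f : (Fin m → G) → Fin n → G} (hf : DefMap L f) {X : Set (Fin m → G)}
    {T : Set (Fin n → G)} (hX : Def L X) (hXT : MapsTo f X T) :
    IsDefinableMap L (singletons X) (singletons T) (image f) := by
  refine ⟨?_, ?_⟩
  · rintro _ ⟨v, hv, rfl⟩
    exact ⟨f v, hXT hv, by simp⟩
  · have : {v : Fin m ⊕ Fin n → G |
        ∃ c ∈ singletons X, v ∘ Sum.inl ∈ c ∧ v ∘ Sum.inr ∈ f '' c} =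
        {v | v ∘ Sum.inl ∈ X} ∩ ⋂ i, {v | f (v ∘ Sum.inl) i = v (Sum.inr i)} := by
      ext v
      constructor
      · rintro ⟨_, ⟨a, ha, rfl⟩, h1, h2⟩
        simp only [mem_singleton_iff, image_singleton] at h1 h2
        refine ⟨by simpa [h1] using ha, mem_iInter.2 fun i => ?_⟩
        simpa [h1] using (congrFun h2 i).symm
      · rintro ⟨h1, h2⟩
        refine ⟨_, ⟨_, h1, rfl⟩, rfl, _, rfl, funext fun i => ?_⟩
        simpa using mem_iInter.1 h2 i
    rw [this]
    refine (hX.preimage_comp Sum.inl).inter (definable_iInter_of_finite fun i => ?_)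
    exact ((hf i).comp fun j => DefinableFun.proj L).ofPred_eq (DefinableFun.proj L)

lemma fibre_singletons (f : (Fin m → G) → Fin n → G) (X : Set (Fin m → G)) (t : Fin n → G) :
    {s | s ∈ singletons X ∧ f '' s = {t}} = singletons {v | v ∈ X ∧ f v = t} := by
  ext c
  constructor
  · rintro ⟨⟨v, hv, rfl⟩, h⟩
    exact ⟨v, ⟨hv, by simpa using h⟩, rfl⟩
  · rintro ⟨v, ⟨hv, rfl⟩, rfl⟩
    exact ⟨⟨v, hv, rfl⟩, by simp⟩

lemma _root_.Set.Definable.fibre {f : (Fin m → G) → Fin n → G} (hf : DefMap L f)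
    {X : Set (Fin m → G)} (hX : Def L X) (t : Fin n → G) : Def L {v | v ∈ X ∧ f v = t} := by
  convert! hX.inter (definable_iInter_of_finite (L := L) (A := (univ : Set G)) fun i : Fin n =>
    (hf i).ofPred_eq_const (mem_univ (t i))) using 1
  ext v
  simp [funext_iff]

lemma IsRanked.exists_not_rkGE (hG : IsRanked L G) {X : Set (Fin n → G)} (hX : Def L X) :
    ∃ k, ¬ RkGE L k X :=
  hG.finite_rank _ (isInterpretable_singletons.2 hX)

lemma IsRanked.exists_rk (hG : IsRanked L G) {X : Set (Fin n → G)} (hX : Def L X) {j : ℕ}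
    (h : RkGE L j X) : ∃ k, j ≤ k ∧ Rk L X k := by
  classical
  have hex := hG.exists_not_rkGE hX
  obtain ⟨k, hk⟩ : ∃ k, Nat.find hex = k + 1 := by
    refine Nat.exists_eq_succ_of_ne_zero fun h0 => Nat.find_spec hex ?_
    rw [h0]
    exact h.of_le (Nat.zero_le j)
  have hr : Rk L X k := by
    refine ⟨?_, ?_⟩
    · by_contra hc
      have := Nat.find_min' hex hc
      omega
    · rw [← hk]
      exact Nat.find_spec hex
  exact ⟨k, hr.le h, hr⟩

lemma IsRanked.definable_rk_fibre (hG : IsRanked L G) {f : (Fin m → G) → Fin n → G}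
    (hf : DefMap L f) {X : Set (Fin m → G)} {T : Set (Fin n → G)} (hX : Def L X) (hT : Def L T)
    (hXT : MapsTo f X T) (k : ℕ) : Def L {t | t ∈ T ∧ Rk L {v | v ∈ X ∧ f v = t} k} := by
  rw [← isInterpretable_singletons]
  convert! hG.definability _ _ _ (isInterpretable_singletons.2 hX) (isInterpretable_singletons.2 hT)
    (isDefinableMap_image hf hX hXT) k using 1
  ext c
  constructor
  · rintro ⟨t, ⟨ht, h⟩, rfl⟩
    refine ⟨mem_singletons.2 ht, ?_⟩
    rw [fibre_singletons]
    exact h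
  · rintro ⟨⟨t, ht, rfl⟩, h⟩
    rw [fibre_singletons] at h
    exact ⟨t, ⟨ht, h⟩, rfl⟩

lemma IsRanked.rk_add (hG : IsRanked L G) {f : (Fin m → G) → Fin n → G}
    (hf : DefMap L f) {X : Set (Fin m → G)} {T : Set (Fin n → G)} (hX : Def L X) (hT : Def L T)
    (hXT : MapsTo f X T) {j k : ℕ} (hj : Rk L T j)
    (hk : ∀ t ∈ T, Rk L {v | v ∈ X ∧ f v = t} k) : Rk L X (j + k) := by
  refine hG.additivity _ _ _ (isInterpretable_singletons.2 hX) (isInterpretable_singletons.2 hT)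
    (isDefinableMap_image hf hX hXT) ?_ j k hj ?_
  · rintro _ ⟨t, ht, rfl⟩
    obtain ⟨v, hv, hvt⟩ := (hk t ht).1.nonempty
    exact ⟨{v}, ⟨v, hv, rfl⟩, by simp [hvt]⟩
  · rintro _ ⟨t, ht, rfl⟩
    rw [fibre_singletons]
    exact hk t ht

/-- If all fibres of a definable map `X → T` have rank at least `k` and `T` has rank at least
`j`, then `X` has rank at least `j + k`. -/
lemma IsRanked.rkGE_add (hG : IsRanked L G) {f : (Fin m → G) → Fin n → G}
    (hf : DefMap L f) {X : Set (Fin m → G)} {T : Set (Fin n → G)} (hX : Def L X) (hT : Def L T)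
    (hXT : MapsTo f X T) {j k : ℕ} (hj : RkGE L j T)
    (hk : ∀ t ∈ T, RkGE L k {v | v ∈ X ∧ f v = t}) : RkGE L (j + k) X := by
  -- The bound `M` allows only finitely many fibre ranks. Some level set `F i` then keeps rank at
  -- least `j`, and additivity applies over it because all its fibres have the same rank.
  obtain ⟨M, hM⟩ := hG.exists_not_rkGE hX
  set F : ℕ → Set (Fin n → G) := fun i => {t | t ∈ T ∧ Rk L {v | v ∈ X ∧ f v = t} i}
  have hF : ∀ i, Def L (F i) := fun i => hG.definable_rk_fibre hf hX hT hXT i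
  have hfib := fun t => hX.fibre hf t
  have hcov : T ⊆ ⋃ i ∈ Finset.range M, F i := fun t ht => by
    obtain ⟨i, -, hi⟩ := hG.exists_rk (hfib t) (hk t ht)
    refine mem_biUnion (Finset.mem_range.2 ?_) ⟨ht, hi⟩
    by_contra! hle
    exact hM ((hi.1.of_le hle).mono fun v hv => hv.1)
  obtain ⟨i, -, hi⟩ := (hj.mono hcov).biUnion _ hF
  obtain ⟨j', hjj', hj'⟩ := hG.exists_rk (hF i) hi
  have hki : k ≤ i := by
    obtain ⟨t, ht⟩ := hi.nonempty
    exact ht.2.le (hk t ht.1)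
  have := hG.rk_add hf (X := X ∩ f ⁻¹' F i) (hX.inter ((hF i).preimage_map hf)) (hF i)
    (fun v hv => hv.2) hj' (k := i) fun t ht => by
      convert! ht.2 using 1
      ext v
      constructor
      · rintro ⟨h1, h2⟩
        exact ⟨h1.1, h2⟩
      · rintro ⟨h1, rfl⟩
        exact ⟨⟨h1, ht⟩, rfl⟩
  exact (this.1.of_le (add_le_add hjj' hki)).mono inter_subset_left

/-- If all nonempty fibres of a definable map `X → T` have rank at most `k` and `T` has rank at
most `j`, then `X` has rank at most `j + k`. -/
lemma IsRanked.not_rkGE_add (hG : IsRanked L G) {f : (Fin m → G) → Fin n → G}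
    (hf : DefMap L f) {X : Set (Fin m → G)} {T : Set (Fin n → G)} (hX : Def L X) (hT : Def L T)
    (hXT : MapsTo f X T) {j k : ℕ} (hj : ¬ RkGE L (j + 1) T)
    (hk : ∀ t ∈ T, ¬ RkGE L (k + 1) {v | v ∈ X ∧ f v = t}) : ¬ RkGE L (j + k + 1) X := by
  intro hcon
  set F : ℕ → Set (Fin n → G) := fun i => {t | t ∈ T ∧ Rk L {v | v ∈ X ∧ f v = t} i}
  have hF : ∀ i, Def L (F i) := fun i => hG.definable_rk_fibre hf hX hT hXT i
  have hfib := fun t => hX.fibre hf t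
  -- Here the source is cut by fibre rank, and a piece of large rank is compared with its image.
  have hcov : X ⊆ ⋃ i ∈ Finset.range (k + 1), X ∩ f ⁻¹' F i := fun v hv => by
    obtain ⟨i, -, hi⟩ := hG.exists_rk (hfib (f v)) (rkGE_zero.2 ⟨v, hv, rfl⟩)
    refine mem_biUnion (Finset.mem_range.2 ?_) ⟨hv, hXT hv, hi⟩
    by_contra! hle
    exact hk _ (hXT hv) (hi.1.of_le hle)
  have hXF : ∀ i, Def L (X ∩ f ⁻¹' F i) := fun i => hX.inter ((hF i).preimage_map hf)
  obtain ⟨i, hik, hi⟩ := (hcon.mono hcov).biUnion _ hXF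
  obtain ⟨v, hv⟩ := hi.nonempty
  obtain ⟨j', -, hj'⟩ := hG.exists_rk (hF i) (rkGE_zero.2 ⟨f v, hv.2⟩)
  have := hG.rk_add hf (hXF i) (hF i)
    (fun v hv => hv.2) hj' (k := i) fun t ht => by
      convert! ht.2 using 1
      ext v
      constructor
      · rintro ⟨h1, h2⟩
        exact ⟨h1.1, h2⟩
      · rintro ⟨h1, rfl⟩
        exact ⟨⟨h1, ht⟩, rfl⟩
  have h1 := this.le hi
  have h2 : j' ≤ j := by
    by_contra! hlt
    exact hj ((hj'.1.of_le hlt).mono fun t ht => ht.1)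
  have h3 := Finset.mem_range.1 hik
  omega

end

/-! ### Irreducible sets, and definable sets as `1`-tuples. -/

section

variable {L : FirstOrder.Language.{u, v}} {G : Type w} [L.Structure G] {m n : ℕ}

/-- A set which is covered by definable sets of rank at least `k` whose pairwise intersections are
small has rank at least `k + 1`. -/
lemma rkGE_succ_of_inter {k : ℕ} {X : Set (Fin n → G)} (A : ℕ → Set (Fin n → G))
    (hAX : ∀ i, A i ⊆ X) (hA : ∀ i, Def L (A i)) (hk : ∀ i, RkGE L k (A i))
    (hd : ∀ i j, i < j → ¬ RkGE L k (A j ∩ A i)) : RkGE L (k + 1) X := by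
  have hU : ∀ i, Def L (⋃ j ∈ Finset.range i, A j) := fun i => definable_biUnion_finset hA _
  -- Removing the earlier sets makes the family disjoint. What is removed from `A i` is a finite
  -- union of sets of rank less than `k`.
  refine rkGE_succ.2 ⟨fun i => A i \ ⋃ j ∈ Finset.range i, A j, fun i j hij => ?_, fun i =>
    ⟨sdiff_subset.trans (hAX i), (hA i).sdiff (hU i), ?_⟩⟩
  · wlog hlt : i < j generalizing i j
    · exact (this j i hij.symm (lt_of_le_of_ne (not_lt.1 hlt) hij.symm)).symm
    rw [Set.disjoint_left]
    exact fun x hx hx' => hx'.2 (mem_biUnion (Finset.mem_range.2 hlt) hx.1)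
  · have h := hk i
    rw [← sdiff_union_inter (A i) (⋃ j ∈ Finset.range i, A j)] at h
    refine (h.union ((hA i).sdiff (hU i)) ((hA i).inter (hU i))).resolve_right fun h' => ?_
    rw [inter_iUnion₂] at h'
    obtain ⟨j, hj, h'⟩ := h'.biUnion _ fun j => (hA i).inter (hA j)
    exact hd j i (Finset.mem_range.1 hj) h'

variable (L) in
/-- A set of rank at least `k` any two definable subsets of which of rank at least `k` have an
intersection of rank at least `k`. -/
def IsIrreducible (k : ℕ) (A : Set (Fin n → G)) : Prop :=
  RkGE L k A ∧ ∀ B C, B ⊆ A → C ⊆ A → Def L B → Def L C → RkGE L k B → RkGE L k C →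
    RkGE L k (B ∩ C)

/-- Otherwise every definable subset of rank `k` splits off a disjoint piece of rank `k` from
another such subset. Iterating gives infinitely many disjoint pieces, against `rk X = k`. -/
lemma exists_isIrreducible {k : ℕ} {X : Set (Fin n → G)} (hX : Def L X) (hk : Rk L X k) :
    ∃ A ⊆ X, Def L A ∧ IsIrreducible L k A := by
  by_contra! hcon
  have step : ∀ A : {A : Set (Fin n → G) // A ⊆ X ∧ Def L A ∧ RkGE L k A},
      ∃ B : {A : Set (Fin n → G) // A ⊆ X ∧ Def L A ∧ RkGE L k A}, ∃ C, B.1 ⊆ A.1 ∧ C ⊆ A.1 ∧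
        Def L C ∧ RkGE L k C ∧ Disjoint C B.1 := by
    rintro ⟨A, hAX, hA, hAk⟩
    have h := hcon A hAX hA
    simp only [IsIrreducible, not_and, not_forall] at h
    obtain ⟨B, C, hB, hC, hBd, hCd, hBk, hCk, hBC⟩ := h hAk
    refine ⟨⟨B, hB.trans hAX, hBd, hBk⟩, C \ B, hB, sdiff_subset.trans hC, hCd.sdiff hBd, ?_,
      disjoint_sdiff_left⟩
    have := hCk
    rw [← sdiff_union_inter C B] at this
    exact (this.union (hCd.sdiff hBd) (hCd.inter hBd)).resolve_right fun h =>
      hBC (by rwa [inter_comm])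
  choose next C hBA hCA hCd hCk hdisj using step
  let seq : ℕ → {A : Set (Fin n → G) // A ⊆ X ∧ Def L A ∧ RkGE L k A} := fun i =>
    Nat.rec ⟨X, subset_rfl, hX, hk.1⟩ (fun _ A => next A) i
  have hanti : Antitone fun i => (seq i).1 := antitone_nat_of_succ_le fun i => hBA (seq i)
  refine hk.2 (rkGE_succ.2 ⟨fun i => C (seq i), fun i j hij => ?_, fun i =>
    ⟨(hCA _).trans (seq i).2.1, hCd _, hCk _⟩⟩)
  wlog hlt : i < j generalizing i j
  · exact (this j i hij.symm (lt_of_le_of_ne (not_lt.1 hlt) hij.symm)).symm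
  exact (hdisj (seq i)).mono_right ((hCA (seq j)).trans (hanti (Nat.succ_le_of_lt hlt)))

/-- A subset of `G` as a set of `1`-tuples. -/
def tuples (X : Set G) : Set (Fin 1 → G) := {v | v 0 ∈ X}

@[simp] lemma mem_tuples {X : Set G} {v : Fin 1 → G} : v ∈ tuples X ↔ v 0 ∈ X := Iff.rfl

lemma tuples_mono {X Y : Set G} (h : X ⊆ Y) : tuples X ⊆ tuples Y := fun _ hv => h hv

lemma exists_eq_tuples (A : Set (Fin 1 → G)) : ∃ X : Set G, A = tuples X := by
  refine ⟨{x | (fun _ => x) ∈ A}, ?_⟩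
  ext v
  rw [mem_tuples, mem_ofPred_eq]
  have : v = fun _ => v 0 := funext fun i => by rw [Subsingleton.elim i 0]
  rw [← this]

lemma points_eq (X : Set G) : points X = singletons (tuples X) := by
  ext c
  constructor
  · rintro ⟨x, hx, rfl⟩
    exact ⟨fun _ => x, hx, rfl⟩
  · rintro ⟨v, hv, rfl⟩
    refine ⟨v 0, hv, ?_⟩
    exact congrArg singleton (funext fun i => by rw [Subsingleton.elim i 0])

lemma hasRank_points {X : Set G} {k : ℕ} : HasRank L (points X) k ↔ Rk L (tuples X) k := by
  rw [points_eq]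
  rfl

variable (L) in
/-- A definable (with parameters) function of several variables. -/
abbrev DefFun {α : Type*} (f : (α → G) → G) : Prop :=
  (univ : Set G).DefinableFun L f

lemma defFun_const {α : Type*} (a : G) : DefFun L fun _ : α → G => a :=
  L.definableFun_const α (mem_univ a)

lemma defFun_proj {α : Type*} (i : α) : DefFun L fun v : α → G => v i :=
  DefinableFun.proj L

lemma IsDefinable.preimage {α : Type*} {f : (α → G) → G} {X : Set G} (hX : IsDefinable L X)
    (hf : DefFun L f) : (univ : Set G).Definable L {v | f v ∈ X} :=
  Set.Definable.preimage_map (F := fun v (_ : Fin 1) => f v) (fun _ => hf) hX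

lemma IsDefinable.inter {X Y : Set G} (hX : IsDefinable L X) (hY : IsDefinable L Y) :
    IsDefinable L (X ∩ Y) :=
  Set.Definable.inter hX hY

lemma IsDefinable.sdiff {X Y : Set G} (hX : IsDefinable L X) (hY : IsDefinable L Y) :
    IsDefinable L (X \ Y) :=
  Set.Definable.sdiff hX hY

lemma isDefinable_univ : IsDefinable L (univ : Set G) :=
  definable_univ

/-- The image of a definable set under a definable function is definable. -/
lemma IsDefinable.image_fun {f : (Fin n → G) → G} {X : Set (Fin n → G)} (hX : Def L X)
    (hf : DefFun L f) : IsDefinable L (f '' X) := by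
  have h : (univ : Set G).Definable L {v : Fin 1 ⊕ Fin n → G |
      v ∘ Sum.inr ∈ X ∧ f (v ∘ Sum.inr) = v (Sum.inl 0)} :=
    (hX.preimage_comp Sum.inr).inter
      ((hf.comp fun j => DefinableFun.proj L).ofPred_eq (DefinableFun.proj L))
  exact h.exists_of_finite

/-- The rank does not grow under definable maps. -/
lemma RkGE.of_surjOn_tuples {f : (Fin n → G) → G} (hf : DefFun L f) {X : Set (Fin n → G)}
    (hX : Def L X) {Y : Set G} (hXY : SurjOn f X Y) {k : ℕ} (h : RkGE L k (tuples Y)) :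
    RkGE L k X := by
  refine h.of_surjOn (f := fun v _ => f v) (fun _ => hf) hX fun v hv => ?_
  obtain ⟨x, hx, hxv⟩ := hXY hv
  exact ⟨x, hx, funext fun i => by rw [Subsingleton.elim i 0]; exact hxv⟩

lemma RkGE.of_surjOn_fun {f : G → G} (hf : DefFun L fun v : Fin 1 → G => f (v 0)) {X Y : Set G}
    (hX : IsDefinable L X) (hXY : SurjOn f X Y) {k : ℕ} (h : RkGE L k (tuples Y)) :
    RkGE L k (tuples X) := by
  refine h.of_surjOn_tuples hf hX fun y hy => ?_
  obtain ⟨x, hx, hxy⟩ := hXY hy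
  exact ⟨fun _ => x, hx, hxy⟩

/-! ### Definable functions in groups, and the descending chain condition. -/

section Group

variable [Group G]

lemma IsGroupOfFiniteMorleyRank.mul (hG : IsGroupOfFiniteMorleyRank L G) {α : Type*}
    {f g : (α → G) → G} (hf : DefFun L f) (hg : DefFun L g) : DefFun L fun v => f v * g v := by
  have h : DefFun L fun v : Fin 2 → G => v 0 * v 1 := by
    have := hG.mul_definable.preimage_comp
      (![some 0, some 1, none] : Fin 3 → Option (Fin 2))
    convert! this using 1
  have := DefinableFun.comp (g := fun v => ![f v, g v]) (f := fun v : Fin 2 → G => v 0 * v 1)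
    (by simp [DefinableMap, hf, hg]) h
  simpa using! this

lemma IsGroupOfFiniteMorleyRank.inv (hG : IsGroupOfFiniteMorleyRank L G) {α : Type*}
    {f : (α → G) → G} (hf : DefFun L f) : DefFun L fun v => (f v)⁻¹ := by
  have h : DefFun L fun v : Fin 1 → G => (v 0)⁻¹ := by
    change (univ : Set G).Definable L (Function.tupleGraph _)
    have := (hG.mul (defFun_proj (L := L) (some 0 : Option (Fin 1)))
      (defFun_proj none)).ofPred_eq_const (mem_univ 1)
    convert! this using 1
    ext v
    simp [Function.tupleGraph, inv_eq_iff_mul_eq_one]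
  exact DefinableFun.comp (g := fun v (_ : Fin 1) => f v) (fun _ => hf) h

lemma IsGroupOfFiniteMorleyRank.pow (hG : IsGroupOfFiniteMorleyRank L G) {α : Type*}
    {f : (α → G) → G} (hf : DefFun L f) (k : ℕ) : DefFun L fun v => f v ^ k := by
  induction k with
  | zero => simpa using defFun_const 1
  | succ k ih =>
    simp only [pow_succ]
    exact hG.mul ih hf

lemma IsGroupOfFiniteMorleyRank.isDefinable_mul_left (hG : IsGroupOfFiniteMorleyRank L G)
    {X : Set G} (hX : IsDefinable L X) (g : G) : IsDefinable L {x | g * x ∈ X} :=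
  hX.preimage (hG.mul (defFun_const g) (defFun_proj 0))

lemma IsGroupOfFiniteMorleyRank.isDefinable_mul_right (hG : IsGroupOfFiniteMorleyRank L G)
    {X : Set G} (hX : IsDefinable L X) (g : G) : IsDefinable L {x | x * g ∈ X} :=
  hX.preimage (hG.mul (defFun_proj 0) (defFun_const g))

lemma IsGroupOfFiniteMorleyRank.rkGE_mul_left (hG : IsGroupOfFiniteMorleyRank L G)
    {X : Set G} (hX : IsDefinable L X) {k : ℕ} (h : RkGE L k (tuples X)) (g : G) :
    RkGE L k (tuples {x | g * x ∈ X}) :=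
  h.of_surjOn_fun (f := fun x => g * x) (hG.mul (defFun_const g) (defFun_proj 0))
    (hG.isDefinable_mul_left hX g) fun y hy => ⟨g⁻¹ * y, by simpa using hy, by simp⟩

lemma IsGroupOfFiniteMorleyRank.rkGE_mul_right (hG : IsGroupOfFiniteMorleyRank L G)
    {X : Set G} (hX : IsDefinable L X) {k : ℕ} (h : RkGE L k (tuples X)) (g : G) :
    RkGE L k (tuples {x | x * g ∈ X}) :=
  h.of_surjOn_fun (f := fun x => x * g) (hG.mul (defFun_proj 0) (defFun_const g))
    (hG.isDefinable_mul_right hX g) fun y hy => ⟨y * g⁻¹, by simpa using hy, by simp⟩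

lemma exists_seq_of_relIndex_eq_zero {K Q : Subgroup G} (h : K.relIndex Q = 0) :
    ∃ g : ℕ → G, (∀ i, g i ∈ Q) ∧ ∀ i j, i ≠ j → (g i)⁻¹ * g j ∉ K := by
  have hinf : Infinite (Q ⧸ K.subgroupOf Q) := Subgroup.index_eq_zero_iff_infinite.1 h
  let e := Infinite.natEmbedding (Q ⧸ K.subgroupOf Q)
  refine ⟨fun i => ((e i).out : Q), fun i => ((e i).out : Q).2, fun i j hij hK => hij ?_⟩
  refine e.injective ?_
  rw [← QuotientGroup.out_eq' (e i), ← QuotientGroup.out_eq' (e j), QuotientGroup.eq,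
    Subgroup.mem_subgroupOf]
  simpa using! hK

/-- The descending chain condition on definable subgroups. -/
lemma IsGroupOfFiniteMorleyRank.exists_minimal (hG : IsGroupOfFiniteMorleyRank L G)
    (P : Subgroup G → Prop) (hP : ∀ K, P K → IsDefinable L (K : Set G)) {K₀ : Subgroup G}
    (hK₀ : P K₀) : ∃ K, P K ∧ ∀ K', P K' → K' ≤ K → K ≤ K' := by
  classical
  by_contra! hcon
  have hrk : ∀ K : {K // P K}, ∃ k, Rk L (tuples (K.1 : Set G)) k := fun K => by
    obtain ⟨k, -, hk⟩ := hG.ranked.exists_rk (hP K.1 K.2) (j := 0) (rkGE_zero.2 ⟨1, K.1.one_mem⟩)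
    exact ⟨k, hk⟩
  have hex : ∃ k, ∃ K : {K // P K}, Rk L (tuples (K.1 : Set G)) k :=
    ⟨_, ⟨K₀, hK₀⟩, (hrk _).choose_spec⟩
  -- Starting at minimal rank, an infinite strictly descending chain has constant rank `r`.
  obtain ⟨K₁, hK₁⟩ := Nat.find_spec hex
  set r := Nat.find hex
  have hge : ∀ K : {K // P K}, RkGE L r (tuples (K.1 : Set G)) := fun K => by
    obtain ⟨k, hk⟩ := hrk K
    exact hk.1.of_le (Nat.find_min' hex ⟨K, hk⟩)
  have step : ∀ K : {K // P K}, ∃ K' : {K // P K}, K'.1 ≤ K.1 ∧ ¬ K.1 ≤ K'.1 := fun K => by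
    obtain ⟨K', h1, h2, h3⟩ := hcon K.1 K.2
    exact ⟨⟨K', h1⟩, h2, h3⟩
  choose next hle hnot using step
  let seq : ℕ → {K // P K} := fun i => Nat.rec K₁ (fun _ K => next K) i
  have hanti : Antitone fun i => (seq i).1 := antitone_nat_of_succ_le fun i => hle (seq i)
  have hd : ∀ i, IsDefinable L ((seq i).1 : Set G) := fun i => hP _ (seq i).2
  refine hK₁.2 (rkGE_succ.2 ⟨fun i => tuples (((seq i).1 : Set G) \ (seq (i + 1)).1),
    fun i j hij => ?_, fun i => ⟨tuples_mono fun x hx => hanti (Nat.zero_le i) hx.1,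
      (hd i).sdiff (hd (i + 1)), ?_⟩⟩)
  · wlog hlt : i < j generalizing i j
    · exact (this j i hij.symm (lt_of_le_of_ne (not_lt.1 hlt) hij.symm)).symm
    rw [Set.disjoint_left]
    exact fun x hx hx' => hx.2 (hanti (Nat.succ_le_of_lt hlt) hx'.1)
  -- Each difference of consecutive groups contains a coset of the smaller group, so it still has
  -- rank `r`.
  · obtain ⟨g, hg, hg'⟩ := SetLike.not_le_iff_exists.1 (hnot (seq i))
    refine (hG.rkGE_mul_left (hd (i + 1)) (hge (seq (i + 1))) g).mono (tuples_mono fun x hx => ?_)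
    have hx1 : g * x ∈ (seq (i + 1)).1 := hx
    refine ⟨?_, fun hx2 => hg' ?_⟩
    · exact ((seq i).1.mul_mem_cancel_left hg).1 (hle (seq i) hx1)
    · exact ((seq (i + 1)).1.mul_mem_cancel_right hx2).1 hx1

end Group

end

/-! ### Rank counting and generic subsets of connected groups. -/

section

variable {L : FirstOrder.Language.{u, v}} {G : Type w} [L.Structure G] {n : ℕ}

lemma IsRanked.rkGE_add_fun (hG : IsRanked L G) {f : (Fin n → G) → G} (hf : DefFun L f)
    {X : Set (Fin n → G)} {T : Set G} (hX : Def L X) (hT : IsDefinable L T)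
    (hXT : MapsTo f X T) {j k : ℕ} (hj : RkGE L j (tuples T))
    (hk : ∀ t ∈ T, RkGE L k {v | v ∈ X ∧ f v = t}) : RkGE L (j + k) X := by
  refine hG.rkGE_add (f := fun v _ => f v) (fun _ => hf) hX hT (fun v hv => hXT hv) hj
    fun t ht => (hk (t 0) ht).mono fun v hv => ⟨hv.1, funext fun i => ?_⟩
  rw [Subsingleton.elim i 0]
  exact hv.2

/-- If all nonempty fibres of a definable map `X → T` have rank at most `k` and `X` has rank at
least `j + k`, then `T` has rank at least `j`. -/
lemma IsRanked.rkGE_of_fibre (hG : IsRanked L G) {f : (Fin n → G) → G} (hf : DefFun L f)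
    {X : Set (Fin n → G)} {T : Set G} (hX : Def L X) (hT : IsDefinable L T)
    (hXT : MapsTo f X T) {j k : ℕ} (hj : RkGE L (j + k) X)
    (hk : ∀ t ∈ T, ¬ RkGE L (k + 1) {v | v ∈ X ∧ f v = t}) : RkGE L j (tuples T) := by
  cases j with
  | zero =>
    obtain ⟨v, hv⟩ := hj.nonempty
    exact rkGE_zero.2 ⟨fun _ => f v, hXT hv⟩
  | succ j =>
    by_contra hcon
    refine hG.not_rkGE_add (f := fun v _ => f v) (fun _ => hf) hX hT (fun v hv => hXT hv) hcon
      (fun t ht h => hk (t 0) ht (h.mono fun v hv => ⟨hv.1, congrFun hv.2 0⟩)) ?_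
    rwa [add_right_comm] at hj

/-- A set of pairs which is the image of a definable set `X` has no larger rank than `X`. -/
lemma RkGE.of_surjOn_pair {f g : G → G} (hf : DefFun L fun v : Fin 1 → G => f (v 0))
    (hg : DefFun L fun v : Fin 1 → G => g (v 0)) {X : Set G} (hX : IsDefinable L X)
    {Y : Set (Fin 2 → G)} (hXY : ∀ v ∈ Y, ∃ x ∈ X, f x = v 0 ∧ g x = v 1) {k : ℕ}
    (h : RkGE L k Y) : RkGE L k (tuples X) := by
  refine h.of_surjOn (f := fun v => ![f (v 0), g (v 0)]) ?_ hX fun v hv => ?_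
  · simp [Set.DefinableMap, hf, hg]
  · obtain ⟨x, hx, h0, h1⟩ := hXY v hv
    refine ⟨fun _ => x, hx, funext fun i => ?_⟩
    fin_cases i <;> simp [h0, h1]


/-- The rank of `G × A`. -/
lemma IsRanked.rkGE_prod (hG : IsRanked L G) {A : Set G} (hA : IsDefinable L A) {d j : ℕ}
    (hd : Rk L (tuples (univ : Set G)) d) :
    RkGE L (j + d) {v : Fin 2 → G | v 1 ∈ A} ↔ RkGE L j (tuples A) := by
  have hdef : Def L {v : Fin 2 → G | v 1 ∈ A} := hA.preimage (defFun_proj 1)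
  constructor
  · intro h
    refine hG.rkGE_of_fibre (defFun_proj 1) hdef hA (fun v hv => hv) h fun t _ ht => hd.2 ?_
    exact ht.of_surjOn_pair (f := fun x => x) (g := fun _ => t) (defFun_proj 0) (defFun_const t)
      isDefinable_univ fun v hv => ⟨v 0, mem_univ _, rfl, hv.2.symm⟩
  · intro h
    refine hG.rkGE_add_fun (defFun_proj 1) hdef hA (fun v hv => hv) h fun t ht => ?_
    refine hd.1.of_surjOn_tuples (defFun_proj 0) (hdef.inter
      ((defFun_proj 1).ofPred_eq_const (mem_univ t))) fun x _ => ⟨![x, t], ⟨?_, ?_⟩, ?_⟩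
    · simpa using ht
    · simp
    · simp

variable [Group G]

/-- The left translates of an irreducible set of maximal rank in a connected group agree with it up
to sets of smaller rank. -/
lemma IsGroupOfFiniteMorleyRank.rkGE_inter_translate (hG : IsGroupOfFiniteMorleyRank L G)
    {K : Subgroup G} (hK : IsDefinable L (K : Set G)) (hKconn : IsConnectedSubgroup L K) {r : ℕ} (hr : Rk L (tuples (K : Set G)) r) {A : Set G} (hA : IsDefinable L A) (hAK : A ⊆ K)
    (hirr : IsIrreducible L r (tuples A)) {g : G} (hg : g ∈ K) :
    RkGE L r (tuples (A ∩ {x | g * x ∈ A})) := by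
  have htr := fun g => hG.isDefinable_mul_left hA g
  have hinv : ∀ g, RkGE L r (tuples (A ∩ {x | g * x ∈ A})) →
      RkGE L r (tuples (A ∩ {x | g⁻¹ * x ∈ A})) := fun g h =>
    (hG.rkGE_mul_left (hA.inter (htr g)) h g⁻¹).mono (tuples_mono fun x hx => by
      simpa [and_comm] using hx)
  -- The stabilizer of `A` modulo smaller rank. Irreducibility of `A` gives closure under products.
  let S : Subgroup G :=
    { carrier := {g | g ∈ K ∧ RkGE L r (tuples (A ∩ {x | g * x ∈ A}))}
      one_mem' := ⟨K.one_mem, by simpa using hirr.1⟩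
      inv_mem' := fun {g} hg => ⟨K.inv_mem hg.1, hinv g hg.2⟩
      mul_mem' := fun {g h} hg hh => by
        refine ⟨K.mul_mem hg.1 hh.1, ?_⟩
        have h1 := hirr.2 _ _ (tuples_mono inter_subset_left) (tuples_mono inter_subset_left)
          (hA.inter (htr g)) (hA.inter (htr h⁻¹)) hg.2 (hinv h hh.2)
        refine (hG.rkGE_mul_left (X := (A ∩ {x | g * x ∈ A}) ∩ (A ∩ {x | h⁻¹ * x ∈ A}))
          ((hA.inter (htr g)).inter (hA.inter (htr h⁻¹))) h1 h).mono (tuples_mono fun x hx => ?_)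
        simp only [mem_inter_iff, mem_ofPred_eq, inv_mul_cancel_left] at hx
        exact ⟨hx.2.2, by simpa [mul_assoc] using hx.1.2⟩ }
  suffices K ≤ S from (this hg).2
  refine hKconn S ?_ fun h0 => ?_
  -- The stabilizer is definable because it is the set of `g ∈ K` over which the fibre of this set
  -- has rank exactly `r`.
  · have hd : Def L {v : Fin 2 → G | v 0 ∈ K ∧ v 1 ∈ A ∧ v 0 * v 1 ∈ A} :=
      (IsDefinable.preimage hK (defFun_proj 0)).inter ((hA.preimage (defFun_proj 1)).inter
        (hA.preimage (hG.mul (defFun_proj 0) (defFun_proj 1))))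
    have := hG.ranked.definable_rk_fibre (f := fun v _ => v 0) (fun _ => defFun_proj 0) hd hK
      (fun v hv => hv.1) r
    change Def L (tuples (S : Set G))
    convert! this using 1
    ext t
    refine and_congr_right fun htK => ?_
    have hfib : ∀ k, RkGE L k (tuples (A ∩ {x | t 0 * x ∈ A})) ↔ RkGE L k {v : Fin 2 → G |
        v ∈ {v : Fin 2 → G | v 0 ∈ K ∧ v 1 ∈ A ∧ v 0 * v 1 ∈ A} ∧ (fun _ => v 0) = t} := by
      intro k
      constructor
      · intro h
        refine h.of_surjOn_tuples (defFun_proj 1) (hd.fibre (fun _ => defFun_proj 0) t) fun x hx =>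
          ⟨![t 0, x], ⟨⟨htK, by simpa using hx.1, by simpa using! hx.2⟩, ?_⟩, by simp⟩
        exact funext fun i => by rw [Subsingleton.elim i 0]; simp
      · intro h
        refine h.of_surjOn_pair (f := fun _ => t 0) (g := fun x => x) (defFun_const _)
          (defFun_proj 0) (hA.inter (htr (t 0))) ?_
        rintro v ⟨hv, rfl⟩
        exact ⟨v 1, hv.2, rfl, rfl⟩
    rw [Rk, ← hfib, ← hfib]
    exact (and_iff_left fun h => hr.2 (h.mono (tuples_mono fun x hx => hAK hx.1))).symm
  -- Infinite index would give infinitely many translates of `A` in `K` with pairwise small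
  -- intersections, hence rank `r + 1`.
  · obtain ⟨a, haK, ha⟩ := exists_seq_of_relIndex_eq_zero h0
    refine hr.2 (rkGE_succ_of_inter (fun i => tuples {x | (a i)⁻¹ * x ∈ A}) (fun i v hv => ?_)
      (fun i => htr _) (fun i => hG.rkGE_mul_left hA hirr.1 _) fun i j hij h => ?_)
    · have := K.mul_mem (haK i) (hAK hv)
      simpa using this
    · refine ha i j hij.ne ⟨K.mul_mem (K.inv_mem (haK i)) (haK j), ?_⟩
      refine (hG.rkGE_mul_left (X := {x | (a j)⁻¹ * x ∈ A} ∩ {x | (a i)⁻¹ * x ∈ A})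
        ((htr _).inter (htr _)) h (a j)).mono (tuples_mono fun x hx => ?_)
      simpa [mul_assoc] using hx

/-- In a connected definable group, two definable subsets of maximal rank have an intersection of
maximal rank. -/
lemma IsGroupOfFiniteMorleyRank.rkGE_inter (hG : IsGroupOfFiniteMorleyRank L G)
    {K : Subgroup G} (hK : IsDefinable L (K : Set G)) (hKconn : IsConnectedSubgroup L K)
    {r : ℕ} (hr : Rk L (tuples (K : Set G)) r) {A B : Set G} (hA : IsDefinable L A)
    (hB : IsDefinable L B) (hAK : A ⊆ K) (hBK : B ⊆ K) (hAr : RkGE L r (tuples A))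
    (hBr : RkGE L r (tuples B)) : RkGE L r (tuples (A ∩ B)) := by
  obtain ⟨C, hCK, hC, hirr⟩ := exists_isIrreducible (L := L) hK hr
  obtain ⟨C, rfl⟩ := exists_eq_tuples C
  replace hC : IsDefinable L C := hC
  replace hCK : C ⊆ K := fun x hx => hCK (show (fun _ => x) ∈ tuples C from hx)
  have hsmall : ∀ B : Set G, IsDefinable L B → B ⊆ K → Disjoint B C → ¬ RkGE L r (tuples B) := by
    intro B hB hBK hBC hBr
    -- Double counting of the pairs `(a, b)` with `a b ∈ C`: over `b` the fibre is a translate of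
    -- `C`, so `P` has rank at least `2 r`. Over `a` the fibre has rank less than `r`, since `C` and
    -- `a C` agree up to small sets while `a B` and `a C` are disjoint.
    set P : Set (Fin 2 → G) := {v | v 0 ∈ K ∧ v 1 ∈ B ∧ v 0 * v 1 ∈ C}
    have hP : Def L P := (IsDefinable.preimage hK (defFun_proj 0)).inter
      ((hB.preimage (defFun_proj 1)).inter
        (hC.preimage (hG.mul (defFun_proj 0) (defFun_proj 1))))
    have hPr : RkGE L (r + r) P := by
      refine hG.ranked.rkGE_add_fun (defFun_proj 1) hP hB (fun v hv => hv.2.1) hBr fun t ht => ?_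
      refine (hG.rkGE_mul_right hC hirr.1 t).of_surjOn_tuples (defFun_proj 0)
        (hP.inter ((defFun_proj 1).ofPred_eq_const (mem_univ t))) fun x hx => ⟨![x, t], ?_, ?_⟩
      · have hxt : x * t ∈ C := hx
        have hxK : x ∈ K := (K.mul_mem_cancel_right (hBK ht)).1 (hCK hxt)
        simp [P, hxK, ht, hxt]
      · simp
    have hfib : ∀ a ∈ K, ¬ RkGE L r (tuples {x | x ∈ B ∧ a * x ∈ C}) := fun a ha h => by
      have h1 := hG.rkGE_inter_translate hK hKconn hr hC hCK hirr (K.inv_mem ha)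
      have hd : IsDefinable L {x | x ∈ B ∧ a * x ∈ C} := hB.inter (hG.isDefinable_mul_left hC a)
      have h2 := hG.rkGE_mul_left hd h a⁻¹
      obtain ⟨v, hv⟩ := (hirr.2 _ _ (tuples_mono inter_subset_left)
        (tuples_mono fun x hx => by simpa using hx.2) (hC.inter (hG.isDefinable_mul_left hC _))
        (hG.isDefinable_mul_left hd _) h1 h2).nonempty
      exact Set.disjoint_left.1 hBC hv.2.1 hv.1.2
    -- For `r = 0` small fibres are empty. For `r = s + 1` they have rank at most `s`, and `2 r = (s
    -- + 2) + s` forces `K` to have rank at least `r + 1`.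
    cases r with
    | zero =>
      obtain ⟨v, hv⟩ := hPr.nonempty
      exact hfib _ hv.1 (rkGE_zero.2 ⟨fun _ => v 1, hv.2⟩)
    | succ s =>
      have := hG.ranked.rkGE_of_fibre (j := s + 2) (k := s) (defFun_proj 0) hP hK
        (fun v hv => hv.1) (by convert! hPr using 1; omega) fun a ha h => hfib a ha <| by
          refine h.of_surjOn_pair (f := fun _ => a) (g := fun x => x) (defFun_const a)
            (defFun_proj 0) (hB.inter (hG.isDefinable_mul_left hC a)) ?_
          rintro v ⟨hv, rfl⟩
          exact ⟨v 1, hv.2, rfl, rfl⟩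
      exact hr.2 this
  have hlarge : ∀ A : Set G, IsDefinable L A → A ⊆ K → RkGE L r (tuples A) →
      RkGE L r (tuples (C ∩ A)) := by
    intro A hA hAK hAr
    rw [inter_comm]
    have : tuples A = tuples (A \ C) ∪ tuples (A ∩ C) := (sdiff_union_inter (tuples A) _).symm
    rw [this] at hAr
    exact (hAr.union (hA.sdiff hC) (hA.inter hC)).resolve_left
      (hsmall _ (hA.sdiff hC) (sdiff_subset.trans hAK) disjoint_sdiff_left)
  exact (hirr.2 _ _ (tuples_mono inter_subset_left) (tuples_mono inter_subset_left)
    (hC.inter hA) (hC.inter hB) (hlarge A hA hAK hAr) (hlarge B hB hBK hBr)).mono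
    fun v hv => ⟨hv.1.2, hv.2.2⟩

end

/-! ### Connected nilpotent subgroups. -/

section

variable {L : FirstOrder.Language.{u, v}} {G : Type w} [L.Structure G] [Group G]

lemma exists_ne_of_relIndex_ne_zero {K Q : Subgroup G} (h : K.relIndex Q ≠ 0) {a : ℕ → G}
    (ha : ∀ i, a i ∈ Q) : ∃ i j, i ≠ j ∧ (a i)⁻¹ * a j ∈ K := by
  have hfin : Finite (Q ⧸ K.subgroupOf Q) := Subgroup.finiteIndex_iff_finite_quotient.1 ⟨h⟩
  obtain ⟨i, j, hij, h⟩ := Finite.exists_ne_map_eq_of_infinite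
    fun i => (QuotientGroup.mk ⟨a i, ha i⟩ : Q ⧸ K.subgroupOf Q)
  exact ⟨i, j, hij, by simpa [Subgroup.mem_subgroupOf] using! QuotientGroup.eq.1 h⟩

lemma IsGroupOfFiniteMorleyRank.isDefinable_conj (hG : IsGroupOfFiniteMorleyRank L G)
    {X : Set G} (hX : IsDefinable L X) (g : G) : IsDefinable L {x | g * x * g⁻¹ ∈ X} :=
  hX.preimage (hG.mul (hG.mul (defFun_const g) (defFun_proj 0)) (defFun_const g⁻¹))

lemma IsGroupOfFiniteMorleyRank.isDefinable_normalizer (hG : IsGroupOfFiniteMorleyRank L G)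
    {H : Subgroup G} (hH : IsDefinable L (H : Set G)) :
    IsDefinable L (Subgroup.normalizer (H : Set G) : Set G) := by
  have hc : DefFun L fun v : Fin 2 → G => v 0 * v 1 * (v 0)⁻¹ :=
    hG.mul (hG.mul (defFun_proj 0) (defFun_proj 1)) (hG.inv (defFun_proj 0))
  have h1 : Def L {v : Fin 2 → G | v 1 ∈ H} := IsDefinable.preimage hH (defFun_proj 1)
  have h2 : Def L {v : Fin 2 → G | v 0 * v 1 * (v 0)⁻¹ ∈ H} := IsDefinable.preimage hH hc
  have h3 := isDefinable_univ.sdiff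
    (IsDefinable.image_fun ((h1.sdiff h2).union (h2.sdiff h1)) (defFun_proj 0))
  convert! h3 using 1
  ext g
  rw [SetLike.mem_coe, Subgroup.mem_normalizer_iff]
  simp only [mem_sdiff, mem_univ, true_and, mem_image,
    not_exists, not_and]
  constructor
  · rintro h v (hv | hv) rfl
    · exact hv.2 ((h _).1 hv.1)
    · exact hv.2 ((h _).2 hv.1)
  · intro h x
    constructor
    · intro hx
      by_contra hcon
      exact h ![g, x] (Or.inl ⟨by simpa using hx, by simpa using hcon⟩) (by simp)
    · intro hx
      by_contra hcon
      exact h ![g, x] (Or.inr ⟨by simpa using hx, by simpa using hcon⟩) (by simp)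

/-- The elements which normalize `D` and commute with `z` modulo `D`. -/
def centralizerMod (D : Subgroup G) (z : G) : Subgroup G where
  carrier := {g | g ∈ Subgroup.normalizer (D : Set G) ∧ g⁻¹ * z⁻¹ * g * z ∈ D}
  one_mem' := ⟨one_mem _, by simp⟩
  mul_mem' := by
    rintro g h ⟨hg, hgz⟩ ⟨hh, hhz⟩
    refine ⟨mul_mem hg hh, ?_⟩
    have := D.mul_mem ((Subgroup.mem_normalizer_iff.1 (inv_mem hh) _).1 hgz) hhz
    convert! this using 1
    group
  inv_mem' := by
    rintro g ⟨hg, hgz⟩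
    refine ⟨inv_mem hg, ?_⟩
    have := (Subgroup.mem_normalizer_iff.1 hg _).1 (D.inv_mem hgz)
    convert! this using 1
    group

lemma IsGroupOfFiniteMorleyRank.isDefinable_centralizerMod (hG : IsGroupOfFiniteMorleyRank L G)
    {D : Subgroup G} (hD : IsDefinable L (D : Set G)) (z : G) :
    IsDefinable L (centralizerMod D z : Set G) :=
  (hG.isDefinable_normalizer hD).inter (IsDefinable.preimage hD
    (f := fun v : Fin 1 → G => (v 0)⁻¹ * z⁻¹ * v 0 * z)
    (hG.mul (hG.mul (hG.mul (hG.inv (defFun_proj 0)) (defFun_const z⁻¹))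
      (defFun_proj 0)) (defFun_const z)))

/-- A connected nilpotent subgroup is contained in a definable subgroup `H` as soon as it has an
element `x` such that the conjugates of `x` in `x H` are obtained from finitely many cosets
of `H`. -/
lemma IsGroupOfFiniteMorleyRank.le_of_isNilpotent (hG : IsGroupOfFiniteMorleyRank L G)
    {Q : Subgroup G} (hQ : IsConnectedSubgroup L Q) (hnil : Group.IsNilpotent Q)
    {H : Subgroup G} (hH : IsDefinable L (H : Set G)) {x : G} (hx : x ∈ Q)
    (hfin : ∀ a : ℕ → G, (∀ i, x⁻¹ * (a i)⁻¹ * x * a i ∈ H) → ∃ i j, i ≠ j ∧ (a i)⁻¹ * a j ∈ H) :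
    Q ≤ H := by
  let Z : ℕ → Subgroup G := fun i => (Subgroup.upperCentralSeries Q i).map Q.subtype
  have hZnorm : ∀ i, ∀ q ∈ Q, ∀ z ∈ Z i, q⁻¹ * z * q ∈ Z i := by
    rintro i q hq _ ⟨z, hz, rfl⟩
    refine ⟨⟨q, hq⟩⁻¹ * z * ⟨q, hq⟩, ?_, by simp⟩
    simpa using (inferInstance : (Subgroup.upperCentralSeries Q i).Normal).conj_mem z hz ⟨q, hq⟩⁻¹
  have hZcomm : ∀ i, ∀ q ∈ Q, ∀ z ∈ Z (i + 1), z⁻¹ * q * z * q⁻¹ ∈ Z i := by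
    rintro i q hq _ ⟨z, hz, rfl⟩
    refine ⟨⁅z⁻¹, ⟨q, hq⟩⁆, ?_, by simp [commutatorElement_def]⟩
    exact Subgroup.mem_upperCentralSeries_succ_iff.1
      ((Subgroup.upperCentralSeries Q (i + 1)).inv_mem hz) ⟨q, hq⟩
  have hind : ∀ i, H.relIndex (Z i) ≠ 0 := by
    intro i
    induction i with
    | zero => simp [Z]
    | succ i ih =>
      -- Minimality places `D` inside `H` and inside its conjugates by elements of `Q`, which makes
      -- `D` normalized by `Q`.
      obtain ⟨D, ⟨hD, hDZ⟩, hmin⟩ := hG.exists_minimal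
        (fun K => IsDefinable L (K : Set G) ∧ K.relIndex (Z i) ≠ 0) (fun K hK => hK.1) ⟨hH, ih⟩
      have hDH : D ≤ H := (hmin (D ⊓ H) ⟨hD.inter hH, Subgroup.relIndex_inf_ne_zero hDZ ih⟩
        inf_le_left).trans inf_le_right
      have hconj : ∀ q ∈ Q, ∀ d ∈ D, q * d * q⁻¹ ∈ D := by
        intro q hq
        let D' : Subgroup G := D.comap (MulAut.conj q).toMonoidHom
        have hD' : ∀ y, y ∈ D' ↔ q * y * q⁻¹ ∈ D := fun y => by simp [D']
        have hD'def : IsDefinable L (D' : Set G) := by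
          convert! hG.isDefinable_conj hD q using 1
        have hD'Z : D'.relIndex (Z i) ≠ 0 := fun h0 => by
          obtain ⟨a, ha, hne⟩ := exists_seq_of_relIndex_eq_zero h0
          obtain ⟨j, k, hjk, h⟩ := exists_ne_of_relIndex_ne_zero hDZ
            (a := fun j => q * a j * q⁻¹)
            fun j => by simpa using hZnorm i q⁻¹ (Q.inv_mem hq) _ (ha j)
          refine hne j k hjk ((hD' _).2 ?_)
          convert! h using 1
          group
        intro d hd
        exact (hD' d).1 ((hmin (D ⊓ D') ⟨hD.inter hD'def,
          Subgroup.relIndex_inf_ne_zero hDZ hD'Z⟩ inf_le_left).trans inf_le_right hd)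
      have hQN : Q ≤ Subgroup.normalizer (D : Set G) := fun q hq =>
        Subgroup.mem_normalizer_iff.2 fun d => ⟨hconj q hq d, fun h => by
          have := hconj q⁻¹ (Q.inv_mem hq) _ h
          simpa [mul_assoc] using this⟩
      -- The commutators of `z` with `Q` lie in `Z i`, hence in finitely many cosets of `D`. So the
      -- centralizer of `z` modulo `D` has finite index in `Q`, and connectedness applies.
      have hcent : ∀ z ∈ Z (i + 1), Q ≤ centralizerMod D z := by
        intro z hz
        refine hQ _ ?_ fun h0 => ?_
        · exact hG.isDefinable_centralizerMod hD z
        · obtain ⟨a, ha, hne⟩ := exists_seq_of_relIndex_eq_zero h0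
          obtain ⟨j, k, hjk, h⟩ := exists_ne_of_relIndex_ne_zero hDZ
            (a := fun j => z⁻¹ * a j * z * (a j)⁻¹) fun j => hZcomm i _ (ha j) z hz
          refine hne j k hjk ⟨hQN (Q.mul_mem (Q.inv_mem (ha j)) (ha k)), ?_⟩
          have := hconj _ (Q.inv_mem (ha k)) _ h
          convert! this using 1
          group
      intro h0
      -- Now `x` commutes with all of `Z (i + 1)` modulo `D ≤ H`, so `hfin` bounds the number of
      -- cosets.
      obtain ⟨a, ha, hne⟩ := exists_seq_of_relIndex_eq_zero h0
      obtain ⟨j, k, hjk, h⟩ := hfin a fun j => hDH (hcent (a j) (ha j) hx).2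
      exact hne j k hjk h
  obtain ⟨c, hc⟩ := hnil.nilpotent
  refine hQ H hH ?_
  have := hind c
  rwa [show Z c = Q by simp [Z, hc, ← MonoidHom.range_eq_map]] at this

end

/-! ### Transporters and generosity. -/

section

variable {L : FirstOrder.Language.{u, v}} {G : Type w} [L.Structure G] [Group G]

/-- The set of elements which conjugate `y` into `H`. -/
def transporter (H : Subgroup G) (y : G) : Set G := {g | g * y * g⁻¹ ∈ H}

lemma IsGroupOfFiniteMorleyRank.isDefinable_transporter (hG : IsGroupOfFiniteMorleyRank L G)
    {H : Subgroup G} (hH : IsDefinable L (H : Set G)) (y : G) :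
    IsDefinable L (transporter H y) :=
  IsDefinable.preimage hH (f := fun v : Fin 1 → G => v 0 * y * (v 0)⁻¹)
    (hG.mul (hG.mul (defFun_proj 0) (defFun_const y)) (hG.inv (defFun_proj 0)))

lemma IsGroupOfFiniteMorleyRank.rkGE_transporter_conj (hG : IsGroupOfFiniteMorleyRank L G)
    {H : Subgroup G} (hH : IsDefinable L (H : Set G)) {y : G} {k : ℕ}
    (h : RkGE L k (tuples (transporter H y))) (g : G) :
    RkGE L k (tuples (transporter H (g⁻¹ * y * g))) := by
  refine (hG.rkGE_mul_right (hG.isDefinable_transporter hH y) h g⁻¹).mono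
    (tuples_mono fun x hx => ?_)
  simpa [transporter, mul_assoc] using! hx

/-- If an element is in a conjugate of `H`, its transporter has at least the rank of `H`. -/
lemma IsGroupOfFiniteMorleyRank.rkGE_transporter (hG : IsGroupOfFiniteMorleyRank L G)
    {H : Subgroup G} (hH : IsDefinable L (H : Set G)) {r : ℕ}
    (hr : RkGE L r (tuples (H : Set G))) {y g : G} (hg : g ∈ transporter H y) :
    RkGE L r (tuples (transporter H y)) := by
  refine (hG.rkGE_mul_right hH hr g⁻¹).mono (tuples_mono fun x hx => ?_)
  have hx' : x * g⁻¹ ∈ H := hx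
  have := H.mul_mem (H.mul_mem hx' hg) (H.inv_mem hx')
  simpa [transporter, mul_assoc] using! this

/-- If the transporter has at most the rank of `H`, it consists of finitely many cosets of `H`. -/
lemma IsGroupOfFiniteMorleyRank.exists_mul_inv_mem (hG : IsGroupOfFiniteMorleyRank L G)
    {H : Subgroup G} (hH : IsDefinable L (H : Set G)) {r : ℕ}
    (hr : RkGE L r (tuples (H : Set G))) {y : G}
    (hy : ¬ RkGE L (r + 1) (tuples (transporter H y))) {a : ℕ → G}
    (ha : ∀ i, a i ∈ transporter H y) : ∃ i j, i ≠ j ∧ a i * (a j)⁻¹ ∈ H := by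
  by_contra! hcon
  refine hy (rkGE_succ.2 ⟨fun i => tuples {x | x * (a i)⁻¹ ∈ H}, fun i j hij => ?_, fun i =>
    ⟨tuples_mono fun x hx => ?_, hG.isDefinable_mul_right hH _, hG.rkGE_mul_right hH hr _⟩⟩)
  · rw [Set.disjoint_left]
    intro v hi hj
    have h1 : v 0 * (a i)⁻¹ ∈ H := hi
    have h2 : v 0 * (a j)⁻¹ ∈ H := hj
    refine hcon i j hij ?_
    simpa using H.mul_mem (H.inv_mem h1) h2
  · have hx' : x * (a i)⁻¹ ∈ H := hx
    have := H.mul_mem (H.mul_mem hx' (ha i)) (H.inv_mem hx')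
    simpa [transporter, mul_assoc] using! this

lemma IsGroupOfFiniteMorleyRank.conj_fun (hG : IsGroupOfFiniteMorleyRank L G) :
    DefFun L fun v : Fin 2 → G => (v 0)⁻¹ * v 1 * v 0 :=
  hG.mul (hG.mul (hG.inv (defFun_proj 0)) (defFun_proj 1)) (defFun_proj 0)

/-- The second coordinate of a point in the fibre is determined by the first, which runs through the
transporter. Ranks of transporters thus become fibre ranks. -/
lemma IsGroupOfFiniteMorleyRank.rkGE_conj_fibre (hG : IsGroupOfFiniteMorleyRank L G)
    {H : Subgroup G} (hH : IsDefinable L (H : Set G)) (y : G) (k : ℕ) :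
    RkGE L k {v : Fin 2 → G | v ∈ {v : Fin 2 → G | v 1 ∈ (H : Set G)} ∧ (v 0)⁻¹ * v 1 * v 0 = y} ↔
      RkGE L k (tuples (transporter H y)) := by
  constructor
  · intro h
    refine h.of_surjOn_pair (f := fun x => x) (g := fun x => x * y * x⁻¹) (defFun_proj 0)
      (hG.mul (hG.mul (defFun_proj 0) (defFun_const y)) (hG.inv (defFun_proj 0)))
      (hG.isDefinable_transporter hH y) ?_
    rintro v ⟨hv, rfl⟩
    refine ⟨v 0, ?_, rfl, by group⟩
    have hv' : v 1 ∈ H := hv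
    simpa [transporter, mul_assoc] using hv'
  · intro h
    refine h.of_surjOn_tuples (defFun_proj 0) ((hH.preimage (defFun_proj 1)).inter
      (hG.conj_fun.ofPred_eq_const (mem_univ y))) fun x hx =>
        ⟨![x, x * y * x⁻¹], ⟨?_, ?_⟩, by simp⟩
    · simpa using! hx
    · simp [mul_assoc]

/-- The elements of `G` which lie in some, but generically only finitely many, conjugates
of `H`. -/
lemma IsGroupOfFiniteMorleyRank.isDefinable_rk_transporter (hG : IsGroupOfFiniteMorleyRank L G)
    {H : Subgroup G} (hH : IsDefinable L (H : Set G)) (r : ℕ) :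
    IsDefinable L {y | Rk L (tuples (transporter H y)) r} := by
  have := hG.ranked.definable_rk_fibre (f := fun v _ => (v 0)⁻¹ * v 1 * v 0)
    (fun _ => hG.conj_fun) (hH.preimage (defFun_proj (1 : Fin 2))) (definable_univ (α := Fin 1))
    (mapsTo_univ _ _) r
  change Def L {t : Fin 1 → G | Rk L (tuples (transporter H (t 0))) r}
  convert! this using 1
  ext t
  rw [mem_ofPred_eq, mem_ofPred_eq, and_iff_right (mem_univ t), Rk, Rk, ← hG.rkGE_conj_fibre hH,
    ← hG.rkGE_conj_fibre hH]
  have : ∀ v : Fin 2 → G, (fun _ => (v 0)⁻¹ * v 1 * v 0) = t ↔ (v 0)⁻¹ * v 1 * v 0 = t 0 :=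
    fun v => by rw [funext_iff, Fin.forall_fin_one]
  simp only [this]

/-- In a generous subgroup `H`, the set of elements whose transporter has the same rank as `H` is
generic. -/
lemma IsGroupOfFiniteMorleyRank.rkGE_inter_of_isGenerous (hG : IsGroupOfFiniteMorleyRank L G)
    {H : Subgroup G} (hgen : IsGenerous L (H : Set G)) {d r : ℕ}
    (hd : Rk L (tuples (univ : Set G)) d) (hr : Rk L (tuples (H : Set G)) r) :
    RkGE L r (tuples ((H : Set G) ∩ {y | Rk L (tuples (transporter H y)) r})) := by
  obtain ⟨hH, hSdef, -, d', hSd, hd'⟩ := hgen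
  set S : Set G := {y | ∃ x ∈ (H : Set G), ∃ g, y = g⁻¹ * x * g}
  rw [hasRank_points] at hSd hd'
  obtain rfl := hd'.eq hd
  set R : Set G := {y | Rk L (tuples (transporter H y)) r}
  have hR : IsDefinable L R := hG.isDefinable_rk_transporter hH r
  have hP : Def L {v : Fin 2 → G | v 1 ∈ (H : Set G)} := hH.preimage (defFun_proj 1)
  have hST : ∀ y ∈ S, ∃ g, g ∈ transporter H y := by
    rintro _ ⟨x, hx, g, rfl⟩
    exact ⟨g, by simpa [transporter, mul_assoc] using hx⟩
  have hSR : RkGE L d (tuples (S ∩ R)) := by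
    have hun : tuples S = tuples (S \ R) ∪ tuples (S ∩ R) := (sdiff_union_inter (tuples S) _).symm
    have h := hSd.1
    rw [hun] at h
    -- If `S \ R` were generic, its fibres of rank at least `r + 1` would give `G × H` rank at least
    -- `d + r + 1`.
    refine (h.union (hSdef.sdiff hR) (hSdef.inter hR)).resolve_left fun h' => ?_
    have hX : Def L ({v : Fin 2 → G | v 1 ∈ (H : Set G)} ∩
        {v : Fin 2 → G | (v 0)⁻¹ * v 1 * v 0 ∈ S \ R}) :=
      hP.inter ((hSdef.sdiff hR).preimage hG.conj_fun)
    have h1 := hG.ranked.rkGE_add_fun (k := r + 1) hG.conj_fun hX (hSdef.sdiff hR)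
      (fun v hv => hv.2) h' fun t ht => by
        obtain ⟨g, hg⟩ := hST t ht.1
        have h2 : RkGE L (r + 1) (tuples (transporter H t)) := by
          by_contra hcon
          exact ht.2 ⟨hG.rkGE_transporter hH hr.1 hg, hcon⟩
        refine ((hG.rkGE_conj_fibre hH t (r + 1)).2 h2).mono ?_
        rintro v ⟨hv, rfl⟩
        exact ⟨⟨hv, ht⟩, rfl⟩
    refine hr.2 ((hG.ranked.rkGE_prod hH hd).1 ?_)
    rw [add_comm]
    exact h1.mono inter_subset_left
  have hHR : IsDefinable L ((H : Set G) ∩ R) := hH.inter hR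
  have hX : Def L {v : Fin 2 → G | v 1 ∈ (H : Set G) ∩ R} := hHR.preimage (defFun_proj 1)
  -- Conjugation invariance of `R` puts the preimage of `S ∩ R`, of rank at least `d + r`, inside `G
  -- × (H ∩ R)`.
  have hRconj : ∀ y g, g⁻¹ * y * g ∈ R → y ∈ R := fun y g h => by
    have hback : g⁻¹⁻¹ * (g⁻¹ * y * g) * g⁻¹ = y := by group
    have hR' : Rk L (tuples (transporter H (g⁻¹ * y * g))) r := h
    refine ⟨?_, fun h' => hR'.2 (hG.rkGE_transporter_conj hH h' g)⟩
    have := hG.rkGE_transporter_conj hH hR'.1 g⁻¹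
    rwa [hback] at this
  refine (hG.ranked.rkGE_prod hHR hd).1 ?_
  rw [add_comm]
  have hY : Def L ({v : Fin 2 → G | v 1 ∈ (H : Set G)} ∩
      {v : Fin 2 → G | (v 0)⁻¹ * v 1 * v 0 ∈ S ∩ R}) :=
    hP.inter ((hSdef.inter hR).preimage hG.conj_fun)
  refine (hG.ranked.rkGE_add_fun (k := r) hG.conj_fun hY (hSdef.inter hR) (fun v hv => hv.2) hSR
    fun t ht => ?_).mono fun v hv => ⟨hv.1, hRconj _ _ hv.2.2⟩
  refine ((hG.rkGE_conj_fibre hH t r).2 ht.2.1).mono ?_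
  rintro v ⟨hv, rfl⟩
  exact ⟨⟨hv, ht⟩, rfl⟩

/-- If `w` centralizes the generous subgroup `H` and `w ^ n ∈ H`, then the conjugates of the
elements of `w H` whose `n`-th power is in few conjugates of `H` form a generic set. -/
lemma IsGroupOfFiniteMorleyRank.exists_generic_conj_coset (hG : IsGroupOfFiniteMorleyRank L G)
    {H : Subgroup G} (hHconn : IsConnectedSubgroup L H)
    (hgen : IsGenerous L (H : Set G)) {d r : ℕ}
    (hd : Rk L (tuples (univ : Set G)) d) (hr : Rk L (tuples (H : Set G)) r) {w : G}
    (hw : ∀ h ∈ H, Commute w h) {n : ℕ} (hn : w ^ n ∈ H)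
    (hpow : IsGenericIn L {x : G | ∃ h ∈ H, x = h ^ n} (H : Set G)) :
    ∃ Y : Set G, IsDefinable L Y ∧ RkGE L d (tuples Y) ∧ ∀ y ∈ Y, ∃ g u : G, y = g⁻¹ * u * g ∧
      w⁻¹ * u ∈ H ∧ ¬ RkGE L (r + 1) (tuples (transporter H (y ^ n))) := by
  have hH := hgen.1
  set R : Set G := {y | Rk L (tuples (transporter H y)) r}
  have hR : IsDefinable L R := hG.isDefinable_rk_transporter hH r
  have hHR := hG.rkGE_inter_of_isGenerous hgen hd hr
  obtain ⟨hXdef, hXH, r', hXr, hr'⟩ := hpow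
  set X : Set G := {x : G | ∃ h ∈ H, x = h ^ n}
  rw [hasRank_points] at hXr hr'
  obtain rfl := hr'.eq hr
  -- The translate by `w ^ n` of the set of `n`-th powers meets `H ∩ R` in rank `r`. Its points are
  -- the powers `(w h) ^ n`.
  have hX' := hG.rkGE_inter hH hHconn hr (hG.isDefinable_mul_left hXdef (w ^ n)⁻¹) (hH.inter hR)
    (fun x hx => by simpa using H.mul_mem hn (hXH hx)) inter_subset_left
    (hG.rkGE_mul_left hXdef hXr.1 _) hHR
  have hpowmem : ∀ u, w⁻¹ * u ∈ H → u ^ n ∈ H := fun u hu => by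
    have : u = w * (w⁻¹ * u) := by group
    rw [this, (hw _ hu).mul_pow]
    exact H.mul_mem hn (H.pow_mem hu n)
  set W : Set G := {u | w⁻¹ * u ∈ H} ∩ {u | u ^ n ∈ R}
  have hW : IsDefinable L W := (hG.isDefinable_mul_left hH w⁻¹).inter
    (hR.preimage (f := fun v : Fin 1 → G => v 0 ^ n) (hG.pow (defFun_proj 0) n))
  have hWr : RkGE L r (tuples W) := by
    refine hX'.of_surjOn_fun (f := fun u => u ^ n) (hG.pow (defFun_proj 0) n) hW ?_
    rintro x ⟨⟨h, hh, hx⟩, -, hxR⟩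
    have : (w * h) ^ n = x := by
      rw [(hw h hh).mul_pow, ← hx]
      group
    refine ⟨w * h, ⟨by simpa using hh, ?_⟩, this⟩
    rw [mem_ofPred_eq, this]
    exact hxR
  have hPW : Def L {v : Fin 2 → G | v 1 ∈ W} := hW.preimage (defFun_proj 1)
  have hconjR : ∀ y g, y ∈ W → ¬ RkGE L (r + 1) (tuples (transporter H ((g⁻¹ * y * g) ^ n))) := by
    intro y g hy h
    have h1 := hG.rkGE_transporter_conj hH h g⁻¹
    have h2 : g⁻¹⁻¹ * (g⁻¹ * y * g) ^ n * g⁻¹ = y ^ n := by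
      have := conj_pow (a := g⁻¹) (b := y) (i := n)
      rw [inv_inv] at this
      rw [this]
      group
    rw [h2] at h1
    exact hy.2.2 h1
  refine ⟨(fun v : Fin 2 → G => (v 0)⁻¹ * v 1 * v 0) '' {v | v 1 ∈ W},
    IsDefinable.image_fun hPW hG.conj_fun, ?_, ?_⟩
  -- The source `G × W` has rank at least `d + r`, and each fibre embeds in the transporter of `y ^
  -- n`, of rank at most `r`.
  · refine hG.ranked.rkGE_of_fibre (k := r) hG.conj_fun hPW
      (IsDefinable.image_fun hPW hG.conj_fun) (mapsTo_image _ _) ?_ ?_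
    · rw [add_comm]
      exact (hG.ranked.rkGE_prod hW hd).2 hWr
    · rintro y ⟨v, hv, rfl⟩ h
      refine hconjR _ (v 0) hv ?_
      set y := (v 0)⁻¹ * v 1 * v 0
      refine h.of_surjOn_pair (f := fun x => x) (g := fun x => x * y * x⁻¹) (defFun_proj 0)
        (hG.mul (hG.mul (defFun_proj 0) (defFun_const y)) (hG.inv (defFun_proj 0)))
        (hG.isDefinable_transporter hH _) ?_
      rintro z ⟨hz, hzy⟩
      have h1 : z 0 * y * (z 0)⁻¹ = z 1 := by
        simp only [y, ← hzy]
        group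
      refine ⟨z 0, ?_, rfl, h1⟩
      change z 0 * y ^ n * (z 0)⁻¹ ∈ H
      rw [← conj_pow, h1]
      exact hpowmem _ hz.1
  · rintro y ⟨v, hv, rfl⟩
    exact ⟨v 0, v 1, rfl, hv.1, hconjR _ _ hv⟩

/-! ### Realizing generic elements, and the theorem. -/

/-- Every generic definable set has an element which belongs to a connected nilpotent subgroup. -/
lemma IsGroupOfFiniteMorleyRank.exists_inConnectedNilpotent (hG : IsGroupOfFiniteMorleyRank L G)
    (hconn : IsConnectedSubgroup L (⊤ : Subgroup G)) (hnil : GenericallyInConnectedNilpotent L G)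
    [Infinite G] {d : ℕ} (hd : Rk L (tuples (univ : Set G)) d) {Y : Set G}
    (hY : IsDefinable L Y) (hYd : RkGE L d (tuples Y)) : ∃ y ∈ Y, InConnectedNilpotent L y := by
  have hinter : ∀ {A B : Set G}, IsDefinable L A → IsDefinable L B → RkGE L d (tuples A) →
      RkGE L d (tuples B) → RkGE L d (tuples (A ∩ B)) := fun {A B} hA hB hAd hBd =>
    hG.rkGE_inter (K := ⊤) (by simpa using isDefinable_univ) hconn (by simpa using hd) hA hB
      (by simp) (by simp) hAd hBd
  have hgen : ∀ {X : Set G}, IsGenericIn L X univ → RkGE L d (tuples X) := by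
    rintro X ⟨-, -, k, hXk, hk⟩
    rw [hasRank_points] at hXk hk
    rw [hk.eq hd]
    exact hXk.1
  rcases hnil with ⟨X, hX, hXQ⟩ | ⟨hsat, A, hA, hAQ⟩
  · obtain ⟨v, hv⟩ := (hinter hY hX.1 hYd (hgen hX)).nonempty
    exact ⟨v 0, hv.1, hXQ _ hv.2⟩
  -- Adding the finitely many parameters of `Y` keeps the parameter set small. The generic sets over
  -- it have generic finite intersections, so saturation yields a point generic over `A` and in `Y`.
  · obtain ⟨B, -, hB⟩ := definable_iff_finitely_definable.1 hY
    have hAB : Cardinal.mk (A ∪ (B : Set G) : Set G) < Cardinal.mk G := by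
      refine (Cardinal.mk_union_le _ _).trans_lt (Cardinal.add_lt_of_lt (Cardinal.aleph0_le_mk G) hA
        ((Cardinal.mk_lt_aleph0_iff.2 ?_).trans_le (Cardinal.aleph0_le_mk G)))
      exact B.finite_toSet
    have hfin : ∀ F : Set (Set G), F.Finite →
        F ⊆ {X | (A ∪ (B : Set G)).Definable₁ L X ∧ RkGE L d (tuples X)} →
          IsDefinable L (⋂₀ F) ∧ RkGE L d (tuples (⋂₀ F)) := by
      intro F hF
      induction F, hF using Set.Finite.induction_on with
      | empty =>
        intro _
        rw [sInter_empty]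
        exact ⟨isDefinable_univ, hd.1⟩
      | @insert X F _ _ ih =>
        intro h
        obtain ⟨h1, h2⟩ := ih ((subset_insert _ _).trans h)
        obtain ⟨h3, h4⟩ := h (mem_insert X F)
        have h3' : IsDefinable L X := Set.Definable.mono h3 (subset_univ _)
        rw [sInter_insert]
        exact ⟨h3'.inter h1, hinter h3' h1 h4 h2⟩
    obtain ⟨y, hy⟩ := hsat _ hAB
      {X | (A ∪ (B : Set G)).Definable₁ L X ∧ RkGE L d (tuples X)} (fun X hX => hX.1) fun F hF hFfin => by
      obtain ⟨v, hv⟩ := (hfin F hFfin hF).2.nonempty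
      exact ⟨v 0, hv⟩
    exact ⟨y, hy Y ⟨Set.Definable.mono hB subset_union_right, hYd⟩, hAQ y fun X hXA hX =>
      hy X ⟨Set.Definable.mono hXA subset_union_left, hgen hX⟩⟩

lemma IsConnectedSubgroup.eq_one_of_finite
    (hconn : IsConnectedSubgroup L (⊤ : Subgroup G)) [Finite G] (g : G) : g = 1 := by
  have hdef : IsDefinable L ((⊥ : Subgroup G) : Set G) := by
    rw [Subgroup.coe_bot]
    exact Set.Definable.singleton_of_mem L (mem_univ 1)
  have := hconn ⊥ hdef (by
    rw [Subgroup.relIndex_top_right]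
    exact Subgroup.index_ne_zero_of_finite)
  exact Subgroup.mem_bot.1 (this (Subgroup.mem_top g))

end

end FMR

theorem mainTheorem2 {L : FirstOrder.Language.{u, v}} {G : Type w} [Group G] [L.Structure G]
    (hG : FMR.IsGroupOfFiniteMorleyRank L G)
    (hconn : FMR.IsConnectedSubgroup L (⊤ : Subgroup G))
    (hnil : FMR.GenericallyInConnectedNilpotent L G)
    (H : Subgroup G)
    (hHdef : FMR.IsDefinable L (H : Set G))
    (hHconn : FMR.IsConnectedSubgroup L H)
    (hHgen : FMR.IsGenerous L (H : Set G))
    (w : G) (hwN : w ∈ Subgroup.normalizer (H : Set G)) (hwH : w ∉ H)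
    (n : ℕ) (hn : IsLeast {m : ℕ | 0 < m ∧ w ^ m ∈ H} n)
    (hpow : FMR.IsGenericIn L {x : G | ∃ h ∈ H, x = h ^ n} (H : Set G)) :
    H ⊓ Subgroup.centralizer {w} < H := by
  rw [inf_lt_left]
  intro hcent
  have hw : ∀ h ∈ H, Commute w h := fun h hh => (Subgroup.mem_centralizer_singleton_iff.1 (hcent hh)).symm
  rcases finite_or_infinite G with hfin | hinf
  · exact hwH (by rw [hconn.eq_one_of_finite w]; exact H.one_mem)
  obtain ⟨d, -, hd⟩ := hG.ranked.exists_rk (FMR.isDefinable_univ (L := L) (G := G)) (j := 0)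
    (FMR.rkGE_zero.2 ⟨1, Set.mem_univ _⟩)
  obtain ⟨r, -, hr⟩ := hG.ranked.exists_rk (X := FMR.tuples (H : Set G)) hHdef (j := 0)
    (FMR.rkGE_zero.2 ⟨1, H.one_mem⟩)
  obtain ⟨Y, hYdef, hYd, hY⟩ :=
    hG.exists_generic_conj_coset hHconn hHgen hd hr hw hn.1.2 hpow
  obtain ⟨x, hxY, Q, hQconn, hQnil, hxQ⟩ :=
    hG.exists_inConnectedNilpotent hconn hnil hd hYdef hYd
  obtain ⟨g, u, hxu, hu, hT⟩ := hY x hxY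
  let H' : Subgroup G := H.comap (MulAut.conj g).toMonoidHom
  have hH' : ∀ y, y ∈ H' ↔ g * y * g⁻¹ ∈ H := fun y => by simp [H']
  have hH'def : FMR.IsDefinable L (H' : Set G) := by
    change FMR.Def L (FMR.tuples (H' : Set G))
    convert! hG.isDefinable_conj hHdef g using 1
  have hpowmem : ∀ u, w⁻¹ * u ∈ H → u ^ n ∈ H := fun u hu => by
    have : u = w * (w⁻¹ * u) := by group
    rw [this, (hw _ hu).mul_pow]
    exact H.mul_mem hn.1.2 (H.pow_mem hu n)
  have hle : Q ≤ H' := by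
    -- If `[x⁻¹, (a i)⁻¹] ∈ H'`, then `g (a i)⁻¹` conjugates `x` into `w H`, hence `x ^ n` into `H`.
    refine hG.le_of_isNilpotent hQconn hQnil hH'def hxQ fun a ha => ?_
    obtain ⟨i, j, hij, h⟩ := hG.exists_mul_inv_mem hHdef hr.1 hT (a := fun i => g * (a i)⁻¹)
      fun i => by
        have h1 := H.mul_mem hu ((hH' _).1 (ha i))
        have h2 : w⁻¹ * (g * (a i)⁻¹ * x * (g * (a i)⁻¹)⁻¹) ∈ H := by
          convert! h1 using 1
          rw [hxu]
          group
        have h3 := hpowmem _ h2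
        rwa [conj_pow] at h3
    refine ⟨i, j, hij, (hH' _).2 ?_⟩
    convert! h using 1
    group
  have h1 := (hH' x).1 (hle hxQ)
  have h2 : g * x * g⁻¹ = u := by
    rw [hxu]
    group
  rw [h2] at h1
  exact hwH (by simpa using H.mul_mem h1 (H.inv_mem hu))
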